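/- **Setting.** Let $r\ge 2$, let $\mathcal A_r$ be the Cayley–Dickson algebra of real dimension $2^r$ (with $\mathcal A_0=\mathbf R$ and $(x+y\ell)(u+v\ell)=(xu-\tilde v y)+(vx+y\tilde u)\ell$, $\tilde z$ being the conjugate of $z$, and $|z|$ its Euclidean norm), and let $\mathcal A_{r,C}=\mathcal A_r\oplus\mathbf i\mathcal A_r$ be its complexification ($\mathbf i$ central, $\mathbf i^2=-1$), with $\|x+\mathbf i y\|^2=2|x|^2+2|y|^2$ for $x,y\in\mathcal A_r$ and $\|z\|^2=\sum_j\|z_j\|^2$ on $\mathcal A_{r,C}^h$. Let $L_r(\mathcal A_{r,C}^n,\mathcal A_{r,C}^h)$ be the space of $\mathbf R$-linear operators $J$ with $J(xu+yv)=(Jx)u+(Jy)v$ for all $x,y\in\mathbf R^n$ and $u,v\in\mathcal A_{r,C}$, and let $L_{r,i}$ be the set of those $J\in L_r$ with $J(\mathcal A_r^n)\subset\mathcal A_r^h$. Let $T=[0,s]$ with $0<s<\infty$, or $T=[0,\infty)$; let $(\Omega,\mathcal F,\mathsf P)$ be a probability space, $E$ the expectation with respect to $\mathsf P$, and $\{\mathcal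 F_t\}_{t\in T}$ a normal filtration: $\mathcal F_0$ contains all $\mathsf P$-null events of $\mathcal F$, and $\mathcal F_t=\bigcap_{v>t}\mathcal F_v$ (for $t$ not the last element of $T$). For $k=0,1$ let $U_k\in L_{r,i}(\mathcal A_{r,C}^n,\mathcal A_{r,C}^n)$ have the form $U_k=\bigoplus_j a_{k,j}B_{k,j}$ with respect to a splitting of $\mathbf R^n$ into consecutive coordinate blocks, where $a_{k,j}\in\mathcal A_r$ and the $B_{k,j}$ are positive definite real matrices, and let $U_k^{1/2}=\bigoplus_j a_{k,j}^{1/2}B_{k,j}^{1/2}$, where $B_{k,j}^{1/2}$ is the positive definite square root and $a_{k,j}^{1/2}$ is a chosen element of $\mathcal A_r$ whose square is $a_{k,j}$. Let $w=w_0+\mathbf i w_1$, where $w_0,w_1$ are independent $\mathcal A_r^n$-valued random functions on $T$ such that $w_k$ is a $U_k$-random function: $w_k(0)=0$, $w_k$ has independent increments, and for $u\le t$ the increment $w_k(t)-w_k(u)$ is distributed as $\sqrt{t-u}\,U_k^{1/2}\eta$ with $\eta$ a standard Gaussian vector in $\mathbf R^n$. Suppose that $w(t)$ is $\mathcal F_t$-measurable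 for each $t\in T$ and that $w(t)-w(u)$ is independent of $\mathcal F_u$ for all $u<t$ in $T$. For $S\in L_r(\mathcal A_{r,C}^n,\mathcal A_{r,C}^h)$ write $S(x+\mathbf i y)=S_{0,0}x+S_{0,1}y+\mathbf i S_{1,0}x+\mathbf i S_{1,1}y$ for $x,y\in\mathcal A_r^n$, with $S_{l,k}\in L_{r,i}$ (these operators are matrices over $\mathcal A_r$ acting by left multiplication, and $^*$ is the conjugate transpose), and put $$F(S;U_0,U_1)=\sum_{l,k=0}^1 \mathrm{Tr}\big(\{S_{l,k}U_k^{1/2}\}\{(U_k^{1/2})^*S_{l,k}^*\}\big).$$ Let $\mathcal G$ be the $\sigma$-algebra on $T\times\Omega$ generated by the sets $(v,t]\times A$ with $v<t$ in $T$, $A\in\mathcal F_v$, and $\{0\}\times A$ with $A\in\mathcal F_0$; a random function is predictable if it is measurable with respect to the completion of $\mathcal G$ by the $(\lambda\times\mathsf P)$-null sets of $\mathcal G$ and their subsets, $\lambda$ being the Lebesgue measure on $T$. For $a<b$ in $T$ let $V_{2,1}(U_0,U_1,a,b,n,h)$ be the family of all predictable $L_r(\mathcal A_{r,C}^n,\mathcal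 A_{r,C}^h)$-valued random functions $S$ on $T$ with $E\int_a^bF(S;U_0,U_1)(\tau)\,d\tau<\infty$. An elementary random function is $S(t)=\sum_{l=0}^{k-1}S_l\,\mathrm{ch}_{(t_l,t_{l+1}]}(t)$ with $0=t_0<t_1<\dots<t_k$ in $T$ and $S_l:\Omega\to L_r(\mathcal A_{r,C}^n,\mathcal A_{r,C}^h)$ being $\mathcal F_{t_l}$-measurable; its stochastic integral over $[\beta,\gamma]$, $\beta\le\gamma$ in $T$, is $$\int_\beta^\gamma S\,dw=\sum_{l=0}^{k-1}S_l\big(w(\beta\vee(t_{l+1}\wedge\gamma))-w(\beta\vee(t_l\wedge\gamma))\big).$$ For a predictable $S$ one says that the stochastic integral $\int_\beta^\gamma S\,dw$ exists and equals the $\mathcal A_{r,C}^h$-valued random variable $Y$ if there is a sequence of elementary random functions $S_\kappa$ with $\lim_\kappa E\int_\beta^\gamma F(S-S_\kappa;U_0,U_1)(\tau)\,d\tau=0$, and for every such sequence $\lim_\kappa E\big\|\int_\beta^\gamma S_\kappa\,dw-Y\big\|^2=0$. **Proposition 2.20.** Let $a<b$ in $T$ and $S\in V_{2,1}(U_0,U_1,a,b,n,h)$.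 Then for all $a\le\beta\le\gamma\le b$ the stochastic integral $\int_\beta^\gamma S\,dw$ exists and is unique up to $\mathsf P$-a.e. equality, and for every $c$ with $a<c<b$ $$\int_a^bS\,dw=\int_a^cS\,dw+\int_c^bS\,dw\qquad \mathsf P\text{-a.e.}$$ -/

import Mathlib

open MeasureTheory ProbabilityTheory Filter Topology
open scoped ENNReal Matrix

noncomputable section

namespace CayleyDickson

/-! ### The Cayley-Dickson algebras and their complexifications -/

/-- The real vector space underlying the Cayley-Dickson algebra `𝒜_r`, of dimension `2 ^ r`, with
its Euclidean norm. The standard basis is indexed by the words of length `r` in two letters; the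
first letter of a word says in which half of the doubling `𝒜_r = 𝒜_{r-1} ⊕ 𝒜_{r-1} ℓ` the basis
element lies. The constant word `false` is the index of the basis element `i_0 = 1`. -/
abbrev CD (r : ℕ) : Type := EuclideanSpace ℝ (Fin r → Bool)

/-- The component `a` of `a + b ℓ` in `𝒜_{r+1}`. -/
def fstHalf {r : ℕ} (x : CD (r + 1)) : CD r :=
  WithLp.toLp 2 fun i => x (Fin.cons false i)

/-- The component `b` of `a + b ℓ` in `𝒜_{r+1}`. -/
def sndHalf {r : ℕ} (x : CD (r + 1)) : CD r :=
  WithLp.toLp 2 fun i => x (Fin.cons true i)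

/-- The element `a + b ℓ` of `𝒜_{r+1}`. -/
def double {r : ℕ} (a b : CD r) : CD (r + 1) :=
  WithLp.toLp 2 fun i => if i 0 = true then b (Fin.tail i) else a (Fin.tail i)

/-- The conjugation `z₀ + z' ↦ z₀ - z'` of `𝒜_r`. -/
def conj {r : ℕ} (x : CD r) : CD r :=
  WithLp.toLp 2 fun i => if i = (fun _ => false) then x i else - x i

/-- The Cayley-Dickson product,
`(a + b ℓ) (c + d ℓ) = (a c - (conj d) b) + (d a + b (conj c)) ℓ`, starting from `𝒜_0 = ℝ`. -/
def cdMul : (r : ℕ) → CD r → CD r → CD r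
  | 0, x, y => WithLp.toLp 2 fun i => x i * y i
  | r + 1, x, y =>
      double
        (cdMul r (fstHalf x) (fstHalf y) - cdMul r (conj (sndHalf y)) (sndHalf x))
        (cdMul r (sndHalf y) (fstHalf x) + cdMul r (sndHalf x) (conj (fstHalf y)))

instance (r : ℕ) : Mul (CD r) := ⟨cdMul r⟩

instance (r : ℕ) : Star (CD r) := ⟨conj⟩

/-- The embedding `t ↦ t i_0` of `ℝ` into `𝒜_r`. -/
def ofReal (r : ℕ) (t : ℝ) : CD r := EuclideanSpace.single (fun _ => false) t

/-- The real part of an element of `𝒜_r`. -/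
def re {r : ℕ} (x : CD r) : ℝ := x (fun _ => false)

lemma cdMul_bilin : ∀ r : ℕ,
    (∀ x x' y : CD r, cdMul r (x + x') y = cdMul r x y + cdMul r x' y) ∧
    (∀ x y y' : CD r, cdMul r x (y + y') = cdMul r x y + cdMul r x y') ∧
    (∀ (t : ℝ) (x y : CD r), cdMul r (t • x) y = t • cdMul r x y) ∧
    (∀ (t : ℝ) (x y : CD r), cdMul r x (t • y) = t • cdMul r x y)
  | 0 => by
      refine ⟨?_, ?_, ?_, ?_⟩ <;> intros <;> ext i <;> simp [cdMul] <;> ring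
  | r + 1 => by
      obtain ⟨h1, h2, h3, h4⟩ := cdMul_bilin r
      have f1 : ∀ x y : CD (r + 1), fstHalf (x + y) = fstHalf x + fstHalf y := fun _ _ => rfl
      have f2 : ∀ x y : CD (r + 1), sndHalf (x + y) = sndHalf x + sndHalf y := fun _ _ => rfl
      have f3 : ∀ (t : ℝ) (x : CD (r + 1)), fstHalf (t • x) = t • fstHalf x := fun _ _ => rfl
      have f4 : ∀ (t : ℝ) (x : CD (r + 1)), sndHalf (t • x) = t • sndHalf x := fun _ _ => rfl
      have c1 : ∀ x y : CD r, conj (x + y) = conj x + conj y := by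
        intro x y; ext i; simp only [conj, PiLp.add_apply]; split_ifs <;> ring
      have c2 : ∀ (t : ℝ) (x : CD r), conj (t • x) = t • conj x := by
        intro t x; ext i; simp only [conj, PiLp.smul_apply, smul_eq_mul]; split_ifs <;> ring
      have d1 : ∀ a b c d : CD r, double (a + b) (c + d) = double a c + double b d := by
        intro a b c d; ext i; simp only [double, PiLp.add_apply]; split_ifs <;> rfl
      have d2 : ∀ (t : ℝ) (a b : CD r), double (t • a) (t • b) = t • double a b := by
        intro t a b; ext i; simp only [double, PiLp.smul_apply]; split_ifs <;> rfl
      refine ⟨?_, ?_, ?_, ?_⟩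
      · intro x x' y
        simp only [cdMul, f1, f2, h1, h2, ← d1]
        congr 1 <;> abel
      · intro x x' y
        simp only [cdMul, f1, f2, c1, h1, h2, ← d1]
        congr 1 <;> abel
      · intro t x y
        simp only [cdMul, f3, f4, h3, h4, ← d2, smul_add, smul_sub]
      · intro t x y
        simp only [cdMul, f3, f4, c2, h3, h4, ← d2, smul_add, smul_sub]

/-- The complexified algebra `𝒜_{r,C} = 𝒜_r ⊕ 𝐢 𝒜_r`; the pair `(b, c)` stands for `b + 𝐢 c`. -/
abbrev CDC (r : ℕ) : Type := WithLp 2 (CD r × CD r)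

/-- The element `b + 𝐢 c` of `𝒜_{r,C}`. -/
def mkC {r : ℕ} (b c : CD r) : CDC r := WithLp.toLp 2 (b, c)

/-- The product of `𝒜_{r,C}`: `𝐢` is central and `𝐢 ^ 2 = -1`. -/
instance (r : ℕ) : Mul (CDC r) :=
  ⟨fun x y => mkC (x.fst * y.fst - x.snd * y.snd) (x.fst * y.snd + x.snd * y.fst)⟩

/-- The embedding of `ℝ` into `𝒜_{r,C}`. -/
def ofRealC (r : ℕ) (t : ℝ) : CDC r := mkC (ofReal r t) 0

lemma add_mulC {r : ℕ} (x x' y : CDC r) : (x + x') * y = x * y + x' * y := by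
  obtain ⟨h1, -, -, -⟩ := cdMul_bilin r
  have h : ∀ a b c : CD r, (a + b) * c = a * c + b * c := h1
  change mkC _ _ = mkC _ _ + mkC _ _
  apply (WithLp.equiv 2 _).injective
  ext1
  · change (x.fst + x'.fst) * y.fst - (x.snd + x'.snd) * y.snd
      = (x.fst * y.fst - x.snd * y.snd) + (x'.fst * y.fst - x'.snd * y.snd)
    rw [h, h]; abel
  · change (x.fst + x'.fst) * y.snd + (x.snd + x'.snd) * y.fst
      = (x.fst * y.snd + x.snd * y.fst) + (x'.fst * y.snd + x'.snd * y.fst)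
    rw [h, h]; abel

lemma smul_mulC {r : ℕ} (t : ℝ) (x y : CDC r) : (t • x) * y = t • (x * y) := by
  obtain ⟨-, -, h3, -⟩ := cdMul_bilin r
  have h : ∀ a c : CD r, (t • a) * c = t • (a * c) := h3 t
  change mkC _ _ = t • mkC _ _
  apply (WithLp.equiv 2 _).injective
  ext1
  · change (t • x.fst) * y.fst - (t • x.snd) * y.snd = t • (x.fst * y.fst - x.snd * y.snd)
    rw [h, h, smul_sub]
  · change (t • x.fst) * y.snd + (t • x.snd) * y.fst = t • (x.fst * y.snd + x.snd * y.fst)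
    rw [h, h, smul_add]

/-- The squared norm of `𝒜_{r,C}^h`: `‖z‖² = ∑ⱼ ‖zⱼ‖²` with `‖b + 𝐢 c‖² = 2 |b|² + 2 |c|²`. -/
def normSq {r h : ℕ} (z : Fin h → CDC r) : ℝ :=
  ∑ j, (2 * ‖(z j).fst‖ ^ 2 + 2 * ‖(z j).snd‖ ^ 2)

/-! ### Operators -/

/-- The vector space `L_r(𝒜_{r,C}^n, 𝒜_{r,C}^h)` of the real-linear operators that are right
`𝒜_{r,C}`-linear in the weak sense: `J (x b + y c) = (J x) b + (J y) c` for real vectors `x`, `y`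
and `b`, `c` in `𝒜_{r,C}`. (All spaces are finite dimensional, so continuity is automatic; it is
built in so that the space carries its usual topology and Borel σ-algebra.) -/
def Lr (r n h : ℕ) : Submodule ℝ ((Fin n → CDC r) →L[ℝ] (Fin h → CDC r)) where
  carrier := {J | ∀ (x y : Fin n → ℝ) (b c : CDC r),
    J (fun j => ofRealC r (x j) * b + ofRealC r (y j) * c)
      = fun i => J (fun j => ofRealC r (x j)) i * b + J (fun j => ofRealC r (y j)) i * c}
  add_mem' := by
    intro J K hJ hK x y b c
    simp only [Set.mem_ofPred_eq] at hJ hK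
    funext i
    simp only [add_apply, hJ, hK, Pi.add_apply, add_mulC]
    abel
  zero_mem' := by
    intro x y b c
    funext i
    have h0 : ∀ z : CDC r, (0 : CDC r) * z = 0 := fun z => by
      simpa using smul_mulC (0 : ℝ) (0 : CDC r) z
    simp [h0]
  smul_mem' := by
    intro t J hJ x y b c
    simp only [Set.mem_ofPred_eq] at hJ
    funext i
    simp only [smul_apply, hJ, Pi.smul_apply, smul_mulC, smul_add]

/-- `J` belongs to `L_{r,i}(𝒜_{r,C}^n, 𝒜_{r,C}^h)`: it maps `𝒜_r^n` into `𝒜_r^h`. -/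
def IsLri {r n h : ℕ} (J : Lr r n h) : Prop :=
  ∀ (x : Fin n → CD r) (i : Fin h), (J.1 (fun j => mkC (x j) 0) i).snd = 0

/-- The element `𝐢 ^ k` of `𝒜_{r,C}`, for `k = 0, 1`. -/
def unitC (r : ℕ) (k : Fin 2) : CDC r :=
  if k = 0 then mkC (ofReal r 1) 0 else mkC 0 (ofReal r 1)

/-- The component `z_l` of `z = z₀ + 𝐢 z₁`, for `l = 0, 1`. -/
def partC {r : ℕ} (l : Fin 2) (z : CDC r) : CD r := if l = 0 then z.fst else z.snd

/-- The operators `S_{l,k}` in the decomposition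
`S (x + 𝐢 y) = S₀₀ x + S₀₁ y + 𝐢 (S₁₀ x) + 𝐢 (S₁₁ y)`, `x, y ∈ 𝒜_r^n`, written as matrices over
`𝒜_r` that act on columns by left multiplication. -/
def block {r n h : ℕ} (S : Lr r n h) (l k : Fin 2) : Matrix (Fin h) (Fin n) (CD r) :=
  Matrix.of fun i j => partC l (S.1 (Pi.single j (unitC r k)) i)

/-- `V` is a square root `U^{1/2}` of the operator `U = ⊕ⱼ aⱼ Bⱼ` on `𝒜_{r,C}^n`: here
`ℝ^n` is split into consecutive coordinate blocks (`p i` is the block of the coordinate `i`), `B` is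
a positive definite real matrix that is block diagonal with blocks `Bⱼ`, `aⱼ ∈ 𝒜_r`,
and `U^{1/2} = ⊕ⱼ aⱼ^{1/2} Bⱼ^{1/2}`, where `Bⱼ^{1/2}` is the positive definite square root and
`aⱼ^{1/2} = cⱼ` is an element of `𝒜_r` with `cⱼ² = aⱼ`. -/
def IsSqrtOf {r n : ℕ} (V U : Lr r n n) : Prop :=
  ∃ (m : ℕ) (p : Fin n → Fin m) (a c : Fin m → CD r) (B R : Matrix (Fin n) (Fin n) ℝ),
    Monotone p ∧ (∀ j, c j * c j = a j) ∧
    B.PosDef ∧ (∀ i k, p i ≠ p k → B i k = 0) ∧ R.PosDef ∧ R * R = B ∧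
    (∀ i k, U.1 (Pi.single k (ofRealC r 1)) i = B i k • mkC (a (p i)) 0) ∧
    (∀ i k, V.1 (Pi.single k (ofRealC r 1)) i = R i k • mkC (c (p i)) 0)

/-- `F(S; U₀, U₁) = ∑_{l,k} Tr ({S_{l,k} U_k^{1/2}} {(U_k^{1/2})^* S_{l,k}^*})`, where `V k` is
`U_k^{1/2}`. The trace is a real element of `𝒜_r`. -/
def F {r n h : ℕ} (V : Fin 2 → Lr r n n) (S : Lr r n h) : ℝ :=
  ∑ l : Fin 2, ∑ k : Fin 2,
    re (Matrix.trace ((block S l k * block (V k) 0 0) *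
      ((block (V k) 0 0)ᴴ * (block S l k)ᴴ)))

/-! ### Random functions -/

section Random

variable {Ω : Type*} [mΩ : MeasurableSpace Ω] {T : Set ℝ} {r n h : ℕ}

/-- The admissible time sets: `[0, s]` with `0 < s < ∞`, and `[0, ∞)`. -/
def IsTimeSet (T : Set ℝ) : Prop := (∃ s : ℝ, 0 < s ∧ T = Set.Icc 0 s) ∨ T = Set.Ici 0

/-- The Lebesgue measure on `T`. -/
def lebesgue (T : Set ℝ) : Measure T := (volume : Measure ℝ).comap Subtype.val

/-- Normal filtrations: `ℱ_0` contains the null events, and `ℱ_t = ⋂_{v > t} ℱ_v` (for `t` that is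
not the last element of `T`). -/
structure IsNormal (P : Measure Ω) (ℱ : Filtration T mΩ) : Prop where
  null : ∀ z : T, (z : ℝ) = 0 → ∀ A : Set Ω, MeasurableSet A → P A = 0 → MeasurableSet[ℱ z] A
  right : ∀ t : T, (∃ v, t < v) → ∀ A : Set Ω,
    (∀ v, t < v → MeasurableSet[ℱ v] A) → MeasurableSet[ℱ t] A

/-- The σ-algebra `𝒢` on `T × Ω` generated by the sets `(v, t] × A` with `A ∈ ℱ_v` and
`{0} × A` with `A ∈ ℱ_0`. -/
@[reducible]
def predictableSigma (ℱ : Filtration T mΩ) : MeasurableSpace (T × Ω) :=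
  MeasurableSpace.generateFrom
    ({s | ∃ (v t : T) (A : Set Ω), v < t ∧ MeasurableSet[ℱ v] A ∧ s = Set.Ioc v t ×ˢ A} ∪
     {s | ∃ (z : T) (A : Set Ω), (z : ℝ) = 0 ∧ MeasurableSet[ℱ z] A ∧ s = {z} ×ˢ A})

/-- The completion `𝒢_μ` of `𝒢` by the null sets of `μ = λ × P`, with `λ` the Lebesgue measure
on `T`. -/
@[reducible]
def predictableCompletion (P : Measure Ω) (ℱ : Filtration T mΩ) : MeasurableSpace (T × Ω) :=
  MeasurableSpace.generateFrom
    ({s | MeasurableSet[predictableSigma ℱ] s} ∪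
     {s | ∃ N, MeasurableSet[predictableSigma ℱ] N ∧
        ((lebesgue T).prod P) N = 0 ∧ s ⊆ N})

/-- Predictable random functions. -/
def IsPredictable {X : Type*} [MeasurableSpace X] (P : Measure Ω) (ℱ : Filtration T mΩ)
    (u : T → Ω → X) : Prop :=
  Measurable[predictableCompletion P ℱ] (fun q : T × Ω => u q.1 q.2)

/-- `w` is an `𝒜_r^n`-valued `U`-random function, where `V = U^{1/2}`: it starts at `0`, has
independent increments, and `w t - w s` is distributed as `U^{1/2} (√(t - s) η)` with `η` a standard
Gaussian vector of `ℝ^n`. That is, `w` has the finite dimensional distributions of `U^{1/2} ξ`, with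
`ξ` a standard Wiener process in `ℝ^n`. -/
structure IsURandomFunction (P : Measure Ω) (V : Lr r n n) (w : T → Ω → Fin n → CD r) : Prop where
  zero : ∀ z : T, (z : ℝ) = 0 → w z = 0
  indep : HasIndepIncrements w P
  law : ∀ s t : T, s ≤ t →
    HasLaw (fun ω => w t ω - w s ω)
      ((stdGaussian (EuclideanSpace ℝ (Fin n))).map fun x i =>
        (V.1 (fun j => ofRealC r (Real.sqrt ((t : ℝ) - (s : ℝ)) * x j)) i).fst) P

/-- The random function `w = w₀ + 𝐢 w₁`. -/
def combine (w₀ w₁ : T → Ω → Fin n → CD r) : T → Ω → Fin n → CDC r :=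
  fun t ω j => mkC (w₀ t ω j) (w₁ t ω j)

/-- The standing conditions on `w = w₀ + 𝐢 w₁` and on the filtration: `w₀` and `w₁` are independent
`U₀`- and `U₁`-random functions, `w` is adapted, and the increments of `w` after the time `s` are
independent of `ℱ_s`. -/
structure IsNoise (P : Measure Ω) (ℱ : Filtration T mΩ) (V : Fin 2 → Lr r n n)
    (w₀ w₁ : T → Ω → Fin n → CD r) : Prop where
  fst : IsURandomFunction P (V 0) w₀
  snd : IsURandomFunction P (V 1) w₁
  indep : IndepFun (fun ω t => w₀ t ω) (fun ω t => w₁ t ω) P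
  adapted : ∀ t : T, Measurable[ℱ t] (combine w₀ w₁ t)
  indep_past : ∀ s t : T, s < t →
    Indep (MeasurableSpace.comap (fun ω => combine w₀ w₁ t ω - combine w₀ w₁ s ω) inferInstance)
      (ℱ s) P

/-- Elementary random functions `S(t) = ∑_{l < k} S_l ch_{(t_l, t_{l+1}]}(t)`, with
`0 = t_0 < ⋯ < t_k` in `T` and `S_l` measurable with respect to `ℱ_{t_l}`. -/
structure Elementary (ℱ : Filtration T mΩ) (r n h : ℕ) where
  k : ℕ
  t : Fin (k + 1) → T
  t_zero : (t 0 : ℝ) = 0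
  t_mono : StrictMono t
  coeff : Fin k → Ω → Lr r n h
  meas : ∀ l, Measurable[ℱ (t l.castSucc)] (coeff l)

/-- The random function `∑_l S_l ch_{(t_l, t_{l+1}]}`. -/
def Elementary.eval {ℱ : Filtration T mΩ} (S : Elementary ℱ r n h) (τ : T) (ω : Ω) : Lr r n h :=
  ∑ l, (Set.Ioc (S.t l.castSucc) (S.t l.succ)).indicator (fun _ => S.coeff l ω) τ

/-- The stochastic integral of an elementary random function over `[β, γ]`: the sum of the values of
`S_l` at the increments of `w` over `(t_l, t_{l+1}] ∩ (β, γ]`. For `β = 0` it is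
`∑_l S_l (w (t_{l+1} ∧ γ) - w (t_l ∧ γ))`. -/
def Elementary.integral {ℱ : Filtration T mΩ} (S : Elementary ℱ r n h)
    (w : T → Ω → Fin n → CDC r) (β γ : T) (ω : Ω) : Fin h → CDC r :=
  ∑ l, (S.coeff l ω).1
    (w (max β (min (S.t l.succ) γ)) ω - w (max β (min (S.t l.castSucc) γ)) ω)

/-- `E ∫_β^γ F(S; U₀, U₁)(τ) dτ`. -/
def energy (P : Measure Ω) (V : Fin 2 → Lr r n n) (β γ : T) (S : T → Ω → Lr r n h) : ℝ≥0∞ :=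
  ∫⁻ ω, (∫⁻ τ in Set.Icc β γ, ENNReal.ofReal (F V (S τ ω)) ∂(lebesgue T)) ∂P

/-- The family `V_{2,1}(U₀, U₁, a, b, n, h)` of the predictable `L_r(𝒜_{r,C}^n, 𝒜_{r,C}^h)`-valued
random functions `S` with `E ∫_a^b F(S; U₀, U₁)(τ) dτ < ∞`. -/
def V21 (P : Measure Ω) (ℱ : Filtration T mΩ) (V : Fin 2 → Lr r n n) (a b : T) (h : ℕ) :
    Set (T → Ω → Lr r n h) :=
  {S | IsPredictable P ℱ S ∧ energy P V a b S < ∞}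

/-- The sequence `S_κ` of elementary random functions is mean absolute square convergent to `S`
on `[β, γ]`. -/
def Approximates (P : Measure Ω) {ℱ : Filtration T mΩ} (V : Fin 2 → Lr r n n) (β γ : T)
    (S : T → Ω → Lr r n h) (Sκ : ℕ → Elementary ℱ r n h) : Prop :=
  Tendsto (fun κ => energy P V β γ (fun τ ω => S τ ω - (Sκ κ).eval τ ω)) atTop (𝓝 0)

/-- The random variable `Y` is (a version of) the stochastic integral `∫_β^γ S dw`: there are
sequences of elementary random functions that are mean absolute square convergent to `S` on `[β, γ]`,
and for each such sequence the integrals `∫_β^γ S_κ dw` converge to `Y` in mean square. -/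
structure IsStochasticIntegral (P : Measure Ω) (ℱ : Filtration T mΩ) (V : Fin 2 → Lr r n n)
    (w : T → Ω → Fin n → CDC r) (S : T → Ω → Lr r n h) (β γ : T) (Y : Ω → Fin h → CDC r) :
    Prop where
  measurable : Measurable Y
  exists_approx : ∃ Sκ : ℕ → Elementary ℱ r n h, Approximates P V β γ S Sκ
  tendsto : ∀ Sκ : ℕ → Elementary ℱ r n h, Approximates P V β γ S Sκ →
    Tendsto (fun κ => ∫⁻ ω, ENNReal.ofReal (normSq ((Sκ κ).integral w β γ ω - Y ω)) ∂P)
      atTop (𝓝 0)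

end Random

end CayleyDickson

end

noncomputable section

namespace CayleyDickson

/-! ### The algebra -/

section Algebra

variable {r : ℕ}

/-! This is the Itô construction: a mean square bound on elementary integrals, density of elementary
random functions, and completion. What needs care is that the algebra is not associative and that
$F$ gives only a seminorm.

Algebra. Weak right linearity makes every operator in `Lr` a matrix acting by left multiplication
(`Lr.apply_single`, `partC_apply`). The noise is $U_k^{1/2}$ applied to a real Gaussian vector, and
real scalars pass through all products, so $S(U_k^{1/2}\eta)$ is a real combination of the columns
of $SU_k^{1/2}$ (`apply_driftVec`). The bracketing in $F$ pairs this same matrix with its conjugate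
transpose. Since conjugation reverses products and $\mathrm{Re}(x\tilde x)=|x|^2$ at every level of
the doubling, $F(S)$ is the squared norm of $S$ under the linear map `coeffMap` (`F_eq_norm_sq`).
Energy is therefore the square of an $L^2$ seminorm on $T\times\Omega$ (`IsTimeSet.energy_eq`), and
neither associativity nor multiplicativity of the norm is used.

Isometry. An increment of the noise is centred and independent of the past. So past-measurable
coefficients may be frozen, a single step has second moment $(t-s)\,E F$ in the Euclidean norm, and
successive steps are orthogonal (`IsNoise.sum_stepTerm`). Hence elementary integration is a
contraction from the energy seminorm to $L^2(\mathsf P)$ (`IsNoise.meanNorm_integral_le`).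

Density. A predictable function agrees almost everywhere with a $\mathcal G$-measurable one. The
generators of $\mathcal G$ form a $\pi$-system whose indicators are elementary up to null sets, and
a Dynkin class argument with truncation gives elementary functions arbitrarily close in energy
(`IsTimeSet.exists_elementary_approx`).

Conclusion. Completeness of $L^2$ gives a limit along one fast sequence, and the contraction forces
every approximating sequence to the same limit. A sequence approximating on $[a,b]$ also
approximates on $[a,c]$ and $[c,b]$, so additivity passes from elementary integrals to the limit. -/

lemma mul_def' (x y : CD r) : x * y = cdMul r x y := rfl

lemma ext_halves {x y : CD (r + 1)} (h₁ : fstHalf x = fstHalf y) (h₂ : sndHalf x = sndHalf y) :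
    x = y := by
  ext i
  have hi := Fin.cons_self_tail i
  rcases hb : i 0 with _ | _
  · have := congrArg (fun z : CD r => z (Fin.tail i)) h₁
    simp only [fstHalf, ← hb, hi] at this
    exact this
  · have := congrArg (fun z : CD r => z (Fin.tail i)) h₂
    simp only [sndHalf, ← hb, hi] at this
    exact this

@[simp] lemma fstHalf_double (a b : CD r) : fstHalf (double a b) = a := by
  ext i; simp [fstHalf, double]

@[simp] lemma sndHalf_double (a b : CD r) : sndHalf (double a b) = b := by
  ext i; simp [sndHalf, double]

lemma fstHalf_mul (x y : CD (r + 1)) :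
    fstHalf (x * y) = fstHalf x * fstHalf y - conj (sndHalf y) * sndHalf x :=
  fstHalf_double _ _

lemma sndHalf_mul (x y : CD (r + 1)) :
    sndHalf (x * y) = sndHalf y * fstHalf x + sndHalf x * conj (fstHalf y) :=
  sndHalf_double _ _

lemma cons_const_iff {c : Bool} (i : Fin r → Bool) :
    ((Fin.cons c i : Fin (r + 1) → Bool) = fun _ => false) ↔ c = false ∧ i = fun _ => false := by
  rw [funext_iff, Fin.forall_fin_succ, funext_iff]
  simp

@[simp] lemma fstHalf_conj (x : CD (r + 1)) : fstHalf (conj x) = conj (fstHalf x) := by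
  ext i
  simp [fstHalf, conj, cons_const_iff]

@[simp] lemma sndHalf_conj (x : CD (r + 1)) : sndHalf (conj x) = - sndHalf x := by
  ext i
  simp [sndHalf, conj, cons_const_iff]

lemma conj_conj (x : CD r) : conj (conj x) = x := by
  ext i; simp only [conj]; split_ifs <;> simp

/-- The conjugation as a linear map. -/
def conjₗ : CD r →ₗ[ℝ] CD r where
  toFun := conj
  map_add' x y := by ext i; simp only [conj, PiLp.add_apply]; split_ifs <;> ring
  map_smul' t x := by
    ext i; simp only [conj, PiLp.smul_apply, smul_eq_mul, RingHom.id_apply]; split_ifs <;> ring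

lemma conj_sub (x y : CD r) : conj (x - y) = conj x - conj y := map_sub conjₗ x y
lemma conj_neg (x : CD r) : conj (-x) = -conj x := map_neg conjₗ x
lemma conj_sum {ι : Type*} (s : Finset ι) (f : ι → CD r) :
    conj (∑ i ∈ s, f i) = ∑ i ∈ s, conj (f i) := map_sum conjₗ f s

lemma norm_conj (x : CD r) : ‖conj x‖ = ‖x‖ := by
  rw [EuclideanSpace.norm_eq, EuclideanSpace.norm_eq]
  congr 2 with i
  simp only [conj]; split_ifs <;> simp

/-- The Cayley-Dickson product as a bilinear map. -/
def mulₗ : CD r →ₗ[ℝ] CD r →ₗ[ℝ] CD r :=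
  LinearMap.mk₂ ℝ (cdMul r) (cdMul_bilin r).1 (cdMul_bilin r).2.2.1
    (cdMul_bilin r).2.1 (cdMul_bilin r).2.2.2

lemma mul_eq (x y : CD r) : x * y = mulₗ x y := rfl

lemma add_mul' (x y z : CD r) : (x + y) * z = x * z + y * z := by simp [mul_eq]
lemma neg_mul' (x y : CD r) : (-x) * y = -(x * y) := by simp [mul_eq]
lemma mul_neg' (x y : CD r) : x * (-y) = -(x * y) := by simp [mul_eq]
lemma zero_mul' (x : CD r) : 0 * x = 0 := by simp [mul_eq]
lemma mul_zero' (x : CD r) : x * 0 = 0 := by simp [mul_eq]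
lemma smul_mul' (t : ℝ) (x y : CD r) : (t • x) * y = t • (x * y) := by simp [mul_eq]
lemma mul_smul' (t : ℝ) (x y : CD r) : x * (t • y) = t • (x * y) := by simp [mul_eq]
lemma mul_sum' {ι : Type*} (s : Finset ι) (x : CD r) (f : ι → CD r) :
    x * (∑ i ∈ s, f i) = ∑ i ∈ s, x * f i := by simp [mul_eq]

/-- Induction along the doubling: the formula for the product is arranged so that reversal at one
level yields reversal at the next. This identifies the second bracket of $F$ as the conjugate
transpose of the first. -/
lemma conj_mul : ∀ {r : ℕ} (x y : CD r), conj (x * y) = conj y * conj x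
  | 0, x, y => by
      ext i
      have hi : i = fun _ => false := Subsingleton.elim _ _
      simp [conj, mul_def', cdMul, hi, mul_comm]
  | r + 1, x, y => by
      have ih : ∀ x y : CD r, conj (x * y) = conj y * conj x := conj_mul
      apply ext_halves
      · simp only [fstHalf_conj, fstHalf_mul, sndHalf_conj, conj_sub, ih, conj_conj, conj_neg,
          neg_mul', mul_neg', neg_neg]
      · simp only [fstHalf_conj, sndHalf_mul, sndHalf_conj, conj_conj, neg_mul', neg_add]
        abel

lemma re_fstHalf (x : CD (r + 1)) : re (fstHalf x) = re x := by
  have h : (Fin.cons false fun _ => false : Fin (r + 1) → Bool) = fun _ => false := by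
    simp [cons_const_iff]
  exact congrArg x h

lemma re_sub (x y : CD r) : re (x - y) = re x - re y := rfl
lemma re_neg (x : CD r) : re (-x) = -re x := rfl

lemma norm_sq_halves (x : CD (r + 1)) : ‖x‖ ^ 2 = ‖fstHalf x‖ ^ 2 + ‖sndHalf x‖ ^ 2 := by
  simp only [EuclideanSpace.norm_sq_eq]
  rw [← (Fin.consEquiv fun _ : Fin (r + 1) => Bool).sum_comp]
  rw [Fintype.sum_prod_type]
  simp [fstHalf, sndHalf, add_comm, Fin.consEquiv]

/-- Only the first half of the product has a real part, and there the two minus signs, from the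
doubling and from the conjugation, cancel. The identity thus holds even where the norm is not
multiplicative. -/
lemma re_mul_conj : ∀ {r : ℕ} (x : CD r), re (x * conj x) = ‖x‖ ^ 2
  | 0, x => by
      rw [EuclideanSpace.norm_sq_eq, Fintype.sum_unique]
      have h : ∀ i j : Fin 0 → Bool, x i = x j := fun i j => by rw [Subsingleton.elim i j]
      simp only [re, mul_def', cdMul, conj, if_true, Real.norm_eq_abs, sq_abs]
      exact (sq _).symm.trans (congrArg (· ^ 2) (h _ _))
  | r + 1, x => by
      have h : re (conj (sndHalf x) * sndHalf x) = ‖sndHalf x‖ ^ 2 := by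
        have := re_mul_conj (conj (sndHalf x))
        rwa [conj_conj, norm_conj] at this
      rw [← re_fstHalf, fstHalf_mul, fstHalf_conj, sndHalf_conj, conj_neg, neg_mul', re_sub, re_neg,
        re_mul_conj, h, norm_sq_halves]
      ring

lemma fstHalf_ofReal (t : ℝ) : fstHalf (ofReal (r + 1) t) = ofReal r t := by
  ext i
  simp [fstHalf, ofReal, cons_const_iff]

lemma sndHalf_ofReal (t : ℝ) : sndHalf (ofReal (r + 1) t) = 0 := by
  ext i
  simp [sndHalf, ofReal, cons_const_iff]

lemma conj_ofReal (t : ℝ) : conj (ofReal r t) = ofReal r t := by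
  ext i
  simp only [conj, ofReal]
  split_ifs with h <;> simp [h]

/-- The two sides are proved together because the doubling formula swaps factors in the second half:
left multiplication at one level calls for right multiplication at the level below. -/
lemma ofReal_mul_and_mul_ofReal :
    ∀ {r : ℕ} (t : ℝ) (x : CD r), ofReal r t * x = t • x ∧ x * ofReal r t = t • x
  | 0, t, x => by
      constructor <;> ext i <;>
      · have hi : i = fun _ => false := Subsingleton.elim _ _
        simp [mul_def', cdMul, ofReal, hi, mul_comm]
  | r + 1, t, x => by
      have h := @ofReal_mul_and_mul_ofReal r t
      constructor <;> apply ext_halves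
      · rw [fstHalf_mul, fstHalf_ofReal, sndHalf_ofReal, (h _).1, mul_zero', sub_zero]; rfl
      · rw [sndHalf_mul, fstHalf_ofReal, sndHalf_ofReal, (h _).2, zero_mul', add_zero]; rfl
      · rw [fstHalf_mul, fstHalf_ofReal, sndHalf_ofReal, (h _).2]
        have : conj (0 : CD r) = 0 := map_zero conjₗ
        rw [this, zero_mul', sub_zero]; rfl
      · rw [sndHalf_mul, fstHalf_ofReal, sndHalf_ofReal, conj_ofReal, (h _).2, zero_mul', zero_add]
        rfl

lemma ofReal_mul (t : ℝ) (x : CD r) : ofReal r t * x = t • x := (ofReal_mul_and_mul_ofReal t x).1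
lemma mul_ofReal (t : ℝ) (x : CD r) : x * ofReal r t = t • x := (ofReal_mul_and_mul_ofReal t x).2

lemma extC {x y : CDC r} (h₁ : x.fst = y.fst) (h₂ : x.snd = y.snd) : x = y :=
  (WithLp.equiv 2 _).injective (Prod.ext h₁ h₂)

@[simp] lemma fst_mkC (b c : CD r) : (mkC b c).fst = b := rfl
@[simp] lemma snd_mkC (b c : CD r) : (mkC b c).snd = c := rfl

lemma fst_mulC (x y : CDC r) : (x * y).fst = x.fst * y.fst - x.snd * y.snd := rfl
lemma snd_mulC (x y : CDC r) : (x * y).snd = x.fst * y.snd + x.snd * y.fst := rfl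

lemma ofRealC_mul (t : ℝ) (x : CDC r) : ofRealC r t * x = t • x := by
  apply extC
  · simp [fst_mulC, ofRealC, ofReal_mul, zero_mul']
  · simp [snd_mulC, ofRealC, ofReal_mul, zero_mul']

lemma ofRealC_eq_smul (t : ℝ) : ofRealC r t = t • ofRealC r 1 := by
  apply extC
  · ext i; simp [ofRealC, ofReal]
  · simp [ofRealC]

end Algebra

/-! ### Operators as matrices, and $F$ as a squared norm -/

section Operators

variable {r n h : ℕ}

/-- The weak linearity condition with the real vectors $e_j$ and $0$. It is what turns an operator
into a matrix acting by left multiplication, without reassociating any product. -/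
lemma Lr.apply_single (S : Lr r n h) (j : Fin n) (z : CDC r) (i : Fin h) :
    S.1 (Pi.single j z) i = S.1 (Pi.single j (ofRealC r 1)) i * z := by
  have key := S.2 (Pi.single j 1) 0 z 0
  have h1 : (fun j' => ofRealC r ((Pi.single j 1 : Fin n → ℝ) j') * z
      + ofRealC r ((0 : Fin n → ℝ) j') * (0 : CDC r)) = Pi.single j z := by
    funext j'
    rw [ofRealC_mul, ofRealC_mul]
    by_cases hj : j' = j
    · subst hj; simp
    · simp [hj]
  have h0 : ofRealC r 0 = 0 := by rw [ofRealC_eq_smul, zero_smul]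
  have h2 : (fun j' => ofRealC r ((Pi.single j 1 : Fin n → ℝ) j'))
      = Pi.single j (ofRealC r 1) := by
    funext j'
    by_cases hj : j' = j
    · subst hj; simp
    · simp [hj, h0]
  have h3 : (fun j' => ofRealC r ((0 : Fin n → ℝ) j')) = 0 := by
    funext j'
    simp [h0]
  have hz : ∀ z : CDC r, (0 : CDC r) * z = 0 := fun z => by
    simpa using smul_mulC (0 : ℝ) (0 : CDC r) z
  rw [h1, h2, h3] at key
  rw [key]
  simp [hz]

lemma Lr.apply_eq_sum (S : Lr r n h) (z : Fin n → CDC r) :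
    S.1 z = ∑ j, S.1 (Pi.single j (z j)) := by
  rw [← map_sum, Finset.univ_sum_single]

@[simp] lemma partC_sum {ι : Type*} (s : Finset ι) (l : Fin 2) (f : ι → CDC r) :
    partC l (∑ i ∈ s, f i) = ∑ i ∈ s, partC l (f i) := by
  fin_cases l
  · exact map_sum (WithLp.fstₗ 2 ℝ (CD r) (CD r)) f s
  · exact map_sum (WithLp.sndₗ 2 ℝ (CD r) (CD r)) f s

lemma partC_add (l : Fin 2) (x y : CDC r) : partC l (x + y) = partC l x + partC l y := by
  fin_cases l <;> rfl

lemma partC_smul (l : Fin 2) (t : ℝ) (x : CDC r) : partC l (t • x) = t • partC l x := by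
  fin_cases l <;> rfl

/-- A matrix over `𝒜_r` applied to a column. -/
lemma partC_apply (S : Lr r n h) (l : Fin 2) (x y : Fin n → CD r) (i : Fin h) :
    partC l (S.1 (fun j => mkC (x j) (y j)) i)
      = ∑ j, block S l 0 i j * x j + ∑ j, block S l 1 i j * y j := by
  rw [Lr.apply_eq_sum, Finset.sum_apply, partC_sum, ← Finset.sum_add_distrib]
  refine Finset.sum_congr rfl fun j _ => ?_
  simp only [block, Matrix.of_apply]
  rw [Lr.apply_single, Lr.apply_single S j (unitC r 0), Lr.apply_single S j (unitC r 1)]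
  generalize S.1 (Pi.single j (ofRealC r 1)) i = z
  fin_cases l
  · simp [partC, unitC, fst_mulC, mul_ofReal, mul_zero', neg_mul', sub_eq_add_neg]
  · simp [partC, unitC, snd_mulC, mul_ofReal, mul_zero', add_comm]

/-- The entry `(i, m)` of the matrix `S_{l,k} U_k^{1/2}`. -/
def coeffMat (V : Fin 2 → Lr r n n) (S : Lr r n h) (l k : Fin 2) (i : Fin h) (m : Fin n) : CD r :=
  ∑ j, block S l k i j * block (V k) 0 0 j m

/-- Each diagonal entry of the bracketed product is a sum of terms $x\tilde x$ with $x$ an entry of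
$S_{l,k}U_k^{1/2}$, so the real part reads off squared norms. -/
lemma F_eq_sum (V : Fin 2 → Lr r n n) (S : Lr r n h) :
    F V S = ∑ l, ∑ k, ∑ i, ∑ m, ‖coeffMat V S l k i m‖ ^ 2 := by
  unfold F
  refine Finset.sum_congr rfl fun l _ => Finset.sum_congr rfl fun k _ => ?_
  have hre : ∀ {ι : Type} (s : Finset ι) (f : ι → CD r),
      re (∑ i ∈ s, f i) = ∑ i ∈ s, re (f i) := by
    intro ι s f
    simp [re]
  rw [Matrix.trace, hre]
  refine Finset.sum_congr rfl fun i _ => ?_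
  rw [Matrix.diag_apply, Matrix.mul_apply, hre]
  refine Finset.sum_congr rfl fun m _ => ?_
  rw [← re_mul_conj]
  congr 2
  rw [Matrix.mul_apply, coeffMat, conj_sum]
  refine Finset.sum_congr rfl fun j _ => ?_
  rw [conj_mul]
  rfl

/-- The Hilbert space of the families of matrices `(S_{l,k} U_k^{1/2})_{l,k}`. -/
abbrev CoeffSpace (r n h : ℕ) : Type :=
  PiLp 2 fun _ : Fin 2 × Fin 2 × Fin h × Fin n => CD r

/-- The linear map `S ↦ (S_{l,k} U_k^{1/2})_{l,k}`. -/
def coeffMap (V : Fin 2 → Lr r n n) : Lr r n h →ₗ[ℝ] CoeffSpace r n h where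
  toFun S := WithLp.toLp 2 fun p => coeffMat V S p.1 p.2.1 p.2.2.1 p.2.2.2
  map_add' S S' := by
    ext1 p
    simp only [PiLp.add_apply, coeffMat, ← Finset.sum_add_distrib, ← add_mul', block,
      Matrix.of_apply, ← partC_add]
    rfl
  map_smul' t S := by
    ext1 p
    simp only [PiLp.smul_apply, coeffMat, Finset.smul_sum, ← smul_mul', block,
      Matrix.of_apply, ← partC_smul]
    rfl

lemma F_eq_norm_sq (V : Fin 2 → Lr r n n) (S : Lr r n h) : F V S = ‖coeffMap V S‖ ^ 2 := by
  rw [F_eq_sum, PiLp.norm_sq_eq_of_L2]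
  simp only [Fintype.sum_prod_type]
  rfl

end Operators

/-! ### Gaussian moments -/

section Gaussian

variable {n : ℕ} {H : Type*} [NormedAddCommGroup H] [InnerProductSpace ℝ H]

/-- The standard Gaussian measure on `ℝⁿ`. -/
abbrev stdGauss (n : ℕ) : Measure (EuclideanSpace ℝ (Fin n)) :=
  stdGaussian (EuclideanSpace ℝ (Fin n))

lemma integral_mul_stdGaussian (i j : Fin n) :
    ∫ x, x i * x j ∂(stdGauss n) = if i = j then 1 else 0 := by
  have h := covariance_eval_multivariateGaussian (μ := (0 : EuclideanSpace ℝ (Fin n)))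
    (S := (1 : Matrix (Fin n) (Fin n) ℝ)) Matrix.PosSemidef.one i j
  rw [multivariateGaussian_zero_one, Matrix.one_apply] at h
  rw [← h, covariance]
  have h0 : ∀ i : Fin n, ∫ x, x i ∂(stdGauss n) = 0 := fun i =>
    integral_strongDual_stdGaussian (EuclideanSpace.proj i : EuclideanSpace ℝ (Fin n) →L[ℝ] ℝ)
  simp [h0]

lemma memLp_two_clm_stdGaussian (L : EuclideanSpace ℝ (Fin n) →L[ℝ] H) :
    MemLp (fun x => L x) 2 (stdGauss n) :=
  L.comp_memLp' IsGaussian.memLp_two_id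

/-- Expanding the square in coordinates, the identity covariance kills the off-diagonal terms and
leaves the Hilbert–Schmidt norm. -/
lemma integral_norm_sq_clm_stdGaussian (L : EuclideanSpace ℝ (Fin n) →L[ℝ] H) :
    ∫ x, ‖L x‖ ^ 2 ∂(stdGauss n) = ∑ m, ‖L (EuclideanSpace.single m 1)‖ ^ 2 := by
  have hmem : ∀ i : Fin n, MemLp (fun x : EuclideanSpace ℝ (Fin n) => x i) 2
      (stdGauss n) := fun i =>
    memLp_two_clm_stdGaussian (EuclideanSpace.proj i : EuclideanSpace ℝ (Fin n) →L[ℝ] ℝ)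
  have hexp : ∀ x : EuclideanSpace ℝ (Fin n), ‖L x‖ ^ 2
      = ∑ i, ∑ j, (x i * x j) * inner ℝ (L (EuclideanSpace.single i 1))
          (L (EuclideanSpace.single j 1)) := by
    intro x
    have hx : L x = ∑ i, x i • L (EuclideanSpace.single i 1) := by
      conv_lhs => rw [← (EuclideanSpace.basisFun (Fin n) ℝ).sum_repr x]
      simp
    rw [← real_inner_self_eq_norm_sq, hx, sum_inner]
    refine Finset.sum_congr rfl fun i _ => ?_
    rw [inner_sum]
    refine Finset.sum_congr rfl fun j _ => ?_
    rw [real_inner_smul_left, real_inner_smul_right]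
    ring
  simp_rw [hexp]
  have hint : ∀ i j : Fin n, Integrable (fun x : EuclideanSpace ℝ (Fin n) => (x i * x j)
      * inner ℝ (L (EuclideanSpace.single i 1)) (L (EuclideanSpace.single j 1))) (stdGauss n) :=
    fun i j => ((hmem i).integrable_mul (hmem j)).mul_const _
  rw [integral_finsetSum _ fun i _ => integrable_finsetSum _ fun j _ => hint i j]
  refine Finset.sum_congr rfl fun i _ => ?_
  rw [integral_finsetSum _ fun j _ => hint i j]
  simp_rw [integral_mul_const, integral_mul_stdGaussian]
  simp

/-- The linear map `x ↦ ∑ₘ xₘ vₘ`. -/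
def sumSMul (v : Fin n → H) : EuclideanSpace ℝ (Fin n) →L[ℝ] H :=
  ∑ m, (EuclideanSpace.proj m : EuclideanSpace ℝ (Fin n) →L[ℝ] ℝ).smulRight (v m)

lemma sumSMul_apply (v : Fin n → H) (x : EuclideanSpace ℝ (Fin n)) :
    sumSMul v x = ∑ m, x m • v m := by
  simp [sumSMul]

lemma sumSMul_single (v : Fin n → H) (m : Fin n) :
    sumSMul v (EuclideanSpace.single m 1) = v m := by
  rw [sumSMul_apply, Finset.sum_eq_single m] <;> simp +contextual

variable [CompleteSpace H]

lemma integral_clm_stdGaussian (L : EuclideanSpace ℝ (Fin n) →L[ℝ] H) :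
    ∫ x, L x ∂(stdGauss n) = 0 := by
  have h := L.integral_comp_comm (IsGaussian.integrable_id (μ := stdGauss n))
  simp only [id_eq, integral_id_stdGaussian, map_zero] at h
  exact h

/-- By Fubini the cross term is integrated first in the second variable, where it vanishes because
the Gaussian is centred. -/
lemma lintegral_norm_sq_pair_stdGaussian (A B : EuclideanSpace ℝ (Fin n) →L[ℝ] H) :
    ∫⁻ p, ENNReal.ofReal (‖A p.1 + B p.2‖ ^ 2) ∂((stdGauss n).prod (stdGauss n))
      = ENNReal.ofReal (∑ m, ‖A (EuclideanSpace.single m 1)‖ ^ 2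
          + ∑ m, ‖B (EuclideanSpace.single m 1)‖ ^ 2) := by
  have hA := memLp_two_clm_stdGaussian A
  have hB := memLp_two_clm_stdGaussian B
  have hmeas : MemLp (fun p : EuclideanSpace ℝ (Fin n) × EuclideanSpace ℝ (Fin n) =>
      A p.1 + B p.2) 2 ((stdGauss n).prod (stdGauss n)) :=
    (hA.comp_measurePreserving measurePreserving_fst).add
      (hB.comp_measurePreserving measurePreserving_snd)
  have hint := hmeas.integrable_norm_pow (by norm_num)
  have hint' : Integrable (fun p : EuclideanSpace ℝ (Fin n) × EuclideanSpace ℝ (Fin n) =>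
      ‖A p.1 + B p.2‖ ^ 2) ((stdGauss n).prod (stdGauss n)) := by exact_mod_cast hint
  rw [← ofReal_integral_eq_lintegral_ofReal hint' (ae_of_all _ fun _ => by positivity)]
  congr 1
  rw [integral_prod _ hint']
  have hA2 : Integrable (fun x => ‖A x‖ ^ 2) (stdGauss n) := by
    exact_mod_cast hA.integrable_norm_pow (by norm_num)
  have hB2 : Integrable (fun x => ‖B x‖ ^ 2) (stdGauss n) := by
    exact_mod_cast hB.integrable_norm_pow (by norm_num)
  have hinner : ∀ x, ∫ y, ‖A x + B y‖ ^ 2 ∂(stdGauss n)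
      = ‖A x‖ ^ 2 + ∑ m, ‖B (EuclideanSpace.single m 1)‖ ^ 2 := by
    intro x
    have hBi : Integrable (fun y => B y) (stdGauss n) := hB.integrable (by norm_num)
    have hc : Integrable (fun y => inner ℝ (A x) (B y)) (stdGauss n) := hBi.const_inner _
    simp_rw [norm_add_sq_real]
    rw [integral_add (by fun_prop) hB2, integral_add (by fun_prop) (by fun_prop),
      integral_const_mul, integral_inner hBi, integral_clm_stdGaussian,
      integral_norm_sq_clm_stdGaussian]
    simp
  simp_rw [hinner]
  rw [integral_add hA2 (by fun_prop), integral_norm_sq_clm_stdGaussian]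
  simp

lemma integral_pair_stdGaussian (A B : EuclideanSpace ℝ (Fin n) →L[ℝ] H) (X : H) :
    ∫ p, inner ℝ X (A p.1 + B p.2) ∂((stdGauss n).prod (stdGauss n)) = 0 := by
  have hA := memLp_two_clm_stdGaussian A
  have hB := memLp_two_clm_stdGaussian B
  have hA' := (hA.comp_measurePreserving
    (measurePreserving_fst (μ := stdGauss n) (ν := stdGauss n))).integrable (by norm_num)
  have hB' := (hB.comp_measurePreserving
    (measurePreserving_snd (μ := stdGauss n) (ν := stdGauss n))).integrable (by norm_num)
  have h1 : Integrable (fun p : EuclideanSpace ℝ (Fin n) × EuclideanSpace ℝ (Fin n) =>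
      A p.1 + B p.2) ((stdGauss n).prod (stdGauss n)) := hA'.add hB'
  rw [integral_inner h1, show ∫ p : EuclideanSpace ℝ (Fin n) × EuclideanSpace ℝ (Fin n),
      A p.1 + B p.2
      ∂((stdGauss n).prod (stdGauss n)) = _ from integral_add hA' hB']
  have e1 := integral_fun_fst (μ := stdGauss n) (ν := stdGauss n) (fun x => A x)
  have e2 := integral_fun_snd (μ := stdGauss n) (ν := stdGauss n) (fun x => B x)
  rw [integral_clm_stdGaussian, smul_zero] at e1 e2
  rw [e1, e2, add_zero, inner_zero_right]

end Gaussian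

/-! ### The increments of the noise -/

/-- The Euclidean space `𝒜_{r,C}^h`. -/
abbrev HSpace (r h : ℕ) : Type := PiLp 2 fun _ : Fin h => CDC r

/-- Isolates the weight 2 of the norm on the complexification, so that the estimates can be carried
out in a genuine Euclidean space. -/
lemma normSq_eq {r h : ℕ} (z : Fin h → CDC r) :
    normSq z = 2 * ‖(WithLp.toLp 2 z : HSpace r h)‖ ^ 2 := by
  rw [PiLp.norm_sq_eq_of_L2, normSq, Finset.mul_sum]
  refine Finset.sum_congr rfl fun j _ => ?_
  rw [WithLp.prod_norm_sq_eq_of_L2]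
  simp only []
  ring

section Increments

variable {r n h : ℕ}

/-- Finite dimension makes the space proper, hence second countable, as joint Borel measurability of
addition requires. -/
lemma measurableAdd₂_of_finiteDimensional (E : Type*) [NormedAddCommGroup E] [NormedSpace ℝ E]
    [FiniteDimensional ℝ E] [MeasurableSpace E] [BorelSpace E] : MeasurableAdd₂ E :=
  have := FiniteDimensional.proper_real E
  inferInstance

lemma measurableSub₂_of_finiteDimensional (E : Type*) [NormedAddCommGroup E] [NormedSpace ℝ E]
    [FiniteDimensional ℝ E] [MeasurableSpace E] [BorelSpace E] : MeasurableSub₂ E :=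
  have := FiniteDimensional.proper_real E
  inferInstance

lemma measurableAdd₂_submodule {E : Type*} [NormedAddCommGroup E] [NormedSpace ℝ E]
    [FiniteDimensional ℝ E] [MeasurableSpace E] [BorelSpace E] (W : Submodule ℝ E) :
    MeasurableAdd₂ W :=
  measurableAdd₂_of_finiteDimensional W

lemma measurableSub₂_submodule {E : Type*} [NormedAddCommGroup E] [NormedSpace ℝ E]
    [FiniteDimensional ℝ E] [MeasurableSpace E] [BorelSpace E] (W : Submodule ℝ E) :
    MeasurableSub₂ W :=
  measurableSub₂_of_finiteDimensional W

instance : MeasurableAdd₂ (HSpace r h) := measurableAdd₂_of_finiteDimensional _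
instance : MeasurableAdd₂ (Lr r n h) := measurableAdd₂_submodule _
instance : MeasurableSub₂ (Lr r n h) := measurableSub₂_submodule _

/-- The `m`-th columns of the matrices `S_{0,k} U_k^{1/2}` and `S_{1,k} U_k^{1/2}`. -/
def colVec (V : Fin 2 → Lr r n n) (S : Lr r n h) (k : Fin 2) (m : Fin n) : HSpace r h :=
  WithLp.toLp 2 fun i => mkC (coeffMat V S 0 k i m) (coeffMat V S 1 k i m)

lemma sum_norm_sq_colVec (V : Fin 2 → Lr r n n) (S : Lr r n h) :
    ∑ m, ‖colVec V S 0 m‖ ^ 2 + ∑ m, ‖colVec V S 1 m‖ ^ 2 = F V S := by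
  have hk : ∀ k, ∑ m, ‖colVec V S k m‖ ^ 2
      = ∑ i, ∑ m, ‖coeffMat V S 0 k i m‖ ^ 2 + ∑ i, ∑ m, ‖coeffMat V S 1 k i m‖ ^ 2 := by
    intro k
    simp_rw [← Finset.sum_add_distrib]
    rw [Finset.sum_comm]
    refine Finset.sum_congr rfl fun m _ => ?_
    rw [PiLp.norm_sq_eq_of_L2]
    refine Finset.sum_congr rfl fun i _ => ?_
    rw [WithLp.prod_norm_sq_eq_of_L2]
    rfl
  rw [hk, hk, F_eq_sum]
  simp only [Fin.sum_univ_two]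
  ring

/-- The value of `U^{1/2}` at `c x`, for a real vector `x`. -/
def driftVec (V : Lr r n n) (c : ℝ) (x : EuclideanSpace ℝ (Fin n)) : Fin n → CD r := fun i =>
  (V.1 (fun j => ofRealC r (c * x j)) i).fst

lemma driftVec_eq (V : Lr r n n) (c : ℝ) (x : EuclideanSpace ℝ (Fin n)) (i : Fin n) :
    driftVec V c x i = ∑ m, x m • c • block V 0 0 i m := by
  have h1 : (fun j => ofRealC r (c * x j)) = ∑ m, (c * x m) • Pi.single m (ofRealC r 1) := by
    funext j
    rw [Finset.sum_apply, ofRealC_eq_smul]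
    simp [Pi.single_apply]
  unfold driftVec
  rw [h1, map_sum, Finset.sum_apply]
  have h2 := partC_sum (r := r) Finset.univ 0
    (fun m => V.1 ((c * x m) • Pi.single m (ofRealC r 1)) i)
  refine h2.trans (Finset.sum_congr rfl fun m _ => ?_)
  rw [map_smul, Pi.smul_apply, partC_smul, smul_smul, mul_comm c]
  rfl

lemma continuous_driftVec (V : Lr r n n) (c : ℝ) : Continuous (driftVec V c) := by
  refine continuous_pi fun i => ?_
  simp_rw [driftVec_eq]
  fun_prop

/-- The random vector `∑ₘ xₘ c (S_{·,k} U_k^{1/2})ₘ` as a function of the real vector `x`. -/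
def colMap (V : Fin 2 → Lr r n n) (S : Lr r n h) (k : Fin 2) (c : ℝ) :
    EuclideanSpace ℝ (Fin n) →L[ℝ] HSpace r h :=
  sumSMul fun m => c • colVec V S k m

lemma colMap_apply (V : Fin 2 → Lr r n n) (S : Lr r n h) (k : Fin 2) (c : ℝ)
    (x : EuclideanSpace ℝ (Fin n)) : colMap V S k c x = ∑ m, x m • c • colVec V S k m :=
  sumSMul_apply _ x

lemma colMap_single (V : Fin 2 → Lr r n n) (S : Lr r n h) (k : Fin 2) (c : ℝ) (m : Fin n) :
    colMap V S k c (EuclideanSpace.single m 1) = c • colVec V S k m :=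
  sumSMul_single _ m

/-- `x + 𝐢 y` for column vectors `x`, `y` over `𝒜_r`. -/
def pairC (x y : Fin n → CD r) : Fin n → CDC r := fun j => mkC (x j) (y j)

/-- Coordinates of $x$ and $y$ are real and slide out of all products, so $S(U^{1/2}x)=(SU^{1/2})x$
despite non-associativity. The value at an increment is thereby linear in a pair of Gaussian
vectors. -/
lemma apply_driftVec (V : Fin 2 → Lr r n n) (S : Lr r n h) (c : ℝ)
    (x y : EuclideanSpace ℝ (Fin n)) :
    (WithLp.toLp 2 (S.1 (pairC (driftVec (V 0) c x) (driftVec (V 1) c y))) : HSpace r h)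
      = colMap V S 0 c x + colMap V S 1 c y := by
  have key : ∀ (l k : Fin 2) (i : Fin h) (x : EuclideanSpace ℝ (Fin n)),
      ∑ j, block S l k i j * driftVec (V k) c x j = ∑ m, x m • c • coeffMat V S l k i m := by
    intro l k i x
    simp_rw [driftVec_eq, mul_sum', mul_smul', coeffMat, Finset.smul_sum]
    rw [Finset.sum_comm]
  have hp : ∀ (l : Fin 2) (i : Fin h), partC l
      (S.1 (pairC (driftVec (V 0) c x) (driftVec (V 1) c y)) i)
      = partC l ((colMap V S 0 c x + colMap V S 1 c y) i) := by
    intro l i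
    rw [show pairC (driftVec (V 0) c x) (driftVec (V 1) c y)
      = fun j => mkC (driftVec (V 0) c x j) (driftVec (V 1) c y j) from rfl, partC_apply,
      key, key, PiLp.add_apply, partC_add, colMap_apply, colMap_apply]
    have hc : ∀ (k : Fin 2) (x : EuclideanSpace ℝ (Fin n)),
        partC l ((∑ m, x m • c • colVec V S k m : HSpace r h) i)
          = ∑ m, x m • c • coeffMat V S l k i m := by
      intro k x
      rw [WithLp.ofLp_sum, Finset.sum_apply, partC_sum]
      refine Finset.sum_congr rfl fun m _ => ?_
      rw [PiLp.smul_apply, PiLp.smul_apply, partC_smul, partC_smul]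
      fin_cases l <;> rfl
    rw [hc, hc]
  ext1 i
  exact extC (hp 0 i) (hp 1 i)

variable {Ω : Type*} [mΩ : MeasurableSpace Ω] {T : Set ℝ} {P : Measure Ω} [IsProbabilityMeasure P]
  {ℱ : Filtration T mΩ} {V : Fin 2 → Lr r n n} {w₀ w₁ : T → Ω → Fin n → CD r}

lemma measurable_pairC :
    Measurable fun p : (Fin n → CD r) × (Fin n → CD r) => pairC p.1 p.2 := by
  have : Continuous fun p : (Fin n → CD r) × (Fin n → CD r) => pairC p.1 p.2 := by
    unfold pairC mkC
    fun_prop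
  exact this.measurable

omit [IsProbabilityMeasure P] in
lemma IsNoise.measurable (hw : IsNoise P ℱ V w₀ w₁) (t : T) : Measurable (combine w₀ w₁ t) :=
  (hw.adapted t).mono (ℱ.le t) le_rfl

/-- Independence of the whole processes $w_0$, $w_1$ passes to their increments, so the joint law is
a product of two Gaussian images. -/
lemma IsNoise.map_increment (hw : IsNoise P ℱ V w₀ w₁) {s t : T} (hst : s ≤ t) :
    P.map (fun ω => combine w₀ w₁ t ω - combine w₀ w₁ s ω)
      = ((stdGaussian (EuclideanSpace ℝ (Fin n))).prod
          (stdGaussian (EuclideanSpace ℝ (Fin n)))).map fun p =>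
        pairC (driftVec (V 0) √((t : ℝ) - s) p.1) (driftVec (V 1) √((t : ℝ) - s) p.2) := by
  have h0 := hw.fst.law s t hst
  have h1 := hw.snd.law s t hst
  have hind : IndepFun (fun ω => w₀ t ω - w₀ s ω) (fun ω => w₁ t ω - w₁ s ω) P :=
    hw.indep.comp (φ := fun f : T → Fin n → CD r => f t - f s)
      (ψ := fun f : T → Fin n → CD r => f t - f s)
      ((measurable_pi_apply t).sub (measurable_pi_apply s))
      ((measurable_pi_apply t).sub (measurable_pi_apply s))
  have hprod := (indepFun_iff_map_prod_eq_prod_map_map h0.aemeasurable h1.aemeasurable).1 hind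
  rw [h0.map_eq, h1.map_eq] at hprod
  have hm := fun k => (continuous_driftVec (V k) √((t : ℝ) - s)).measurable
  change _ = ((stdGaussian (EuclideanSpace ℝ (Fin n))).map (driftVec (V 0) √((t : ℝ) - s))).prod
    ((stdGaussian (EuclideanSpace ℝ (Fin n))).map (driftVec (V 1) √((t : ℝ) - s))) at hprod
  rw [Measure.map_prod_map _ _ (hm 0) (hm 1)] at hprod
  have hc : (fun ω => combine w₀ w₁ t ω - combine w₀ w₁ s ω)
      = (fun p : (Fin n → CD r) × (Fin n → CD r) => pairC p.1 p.2) ∘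
        fun ω => (w₀ t ω - w₀ s ω, w₁ t ω - w₁ s ω) := rfl
  rw [hc, ← AEMeasurable.map_map_of_aemeasurable measurable_pairC.aemeasurable
    (h0.aemeasurable.prodMk h1.aemeasurable), hprod,
    Measure.map_map measurable_pairC ((hm 0).prodMap (hm 1))]
  rfl

lemma measurable_driftPair (V : Fin 2 → Lr r n n) (c : ℝ) :
    Measurable fun p : EuclideanSpace ℝ (Fin n) × EuclideanSpace ℝ (Fin n) =>
      pairC (driftVec (V 0) c p.1) (driftVec (V 1) c p.2) :=
  measurable_pairC.comp
    (((continuous_driftVec (V 0) c).measurable).prodMap ((continuous_driftVec (V 1) c).measurable))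

lemma measurable_apply_pair :
    Measurable fun p : Lr r n h × (Fin n → CDC r) => (WithLp.toLp 2 (p.1.1 p.2) : HSpace r h) := by
  have : Continuous fun p : Lr r n h × (Fin n → CDC r) =>
      (WithLp.toLp 2 (p.1.1 p.2) : HSpace r h) := by
    fun_prop
  exact this.measurable

lemma IsNoise.lintegral_norm_sq_apply_law (hw : IsNoise P ℱ V w₀ w₁) {s t : T} (hst : s ≤ t)
    (S : Lr r n h) :
    ∫⁻ δ, ENNReal.ofReal (‖(WithLp.toLp 2 (S.1 δ) : HSpace r h)‖ ^ 2)
        ∂(P.map (fun ω => combine w₀ w₁ t ω - combine w₀ w₁ s ω))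
      = ENNReal.ofReal ((t : ℝ) - s) * ENNReal.ofReal (F V S) := by
  have hts : 0 ≤ (t : ℝ) - s := sub_nonneg.2 hst
  rw [hw.map_increment hst, lintegral_map _ (measurable_driftPair V _)]
  · simp_rw [apply_driftVec]
    rw [lintegral_norm_sq_pair_stdGaussian, ← ENNReal.ofReal_mul hts, ← sum_norm_sq_colVec]
    simp_rw [colMap_single, norm_smul, mul_pow, Real.norm_eq_abs, sq_abs, Real.sq_sqrt hts,
      ← Finset.mul_sum, mul_add]
  · have : Measurable fun δ => (WithLp.toLp 2 (S.1 δ) : HSpace r h) :=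
      measurable_apply_pair.comp (measurable_const.prodMk measurable_id)
    exact (this.norm.pow_const 2).ennreal_ofReal

lemma IsNoise.integral_inner_apply_law (hw : IsNoise P ℱ V w₀ w₁) {s t : T} (hst : s ≤ t)
    (S : Lr r n h) (X : HSpace r h) :
    ∫ δ, inner ℝ X (WithLp.toLp 2 (S.1 δ) : HSpace r h)
        ∂(P.map (fun ω => combine w₀ w₁ t ω - combine w₀ w₁ s ω)) = 0 := by
  rw [hw.map_increment hst, integral_map (measurable_driftPair V _).aemeasurable]
  · simp_rw [apply_driftVec]
    exact integral_pair_stdGaussian _ _ X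
  · have : Measurable fun δ => (WithLp.toLp 2 (S.1 δ) : HSpace r h) :=
      measurable_apply_pair.comp (measurable_const.prodMk measurable_id)
    exact (measurable_const.inner this).aestronglyMeasurable

/-- An increment of the noise is independent of the past. -/
lemma IsNoise.map_prod_increment (hw : IsNoise P ℱ V w₀ w₁) {s t : T} (hst : s < t)
    {X : Type*} [MeasurableSpace X] {C : Ω → X} (hC : Measurable[ℱ s] C) :
    P.map (fun ω => (C ω, combine w₀ w₁ t ω - combine w₀ w₁ s ω))
      = (P.map C).prod (P.map (fun ω => combine w₀ w₁ t ω - combine w₀ w₁ s ω)) := by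
  have hind : IndepFun C (fun ω => combine w₀ w₁ t ω - combine w₀ w₁ s ω) P := by
    rw [IndepFun_iff_Indep]
    exact indep_of_indep_of_le_left (hw.indep_past s t hst).symm hC.comap_le
  exact (indepFun_iff_map_prod_eq_prod_map_map (hC.mono (ℱ.le s) le_rfl).aemeasurable
    ((hw.measurable t).sub (hw.measurable s)).aemeasurable).1 hind

/-- Freezing: a past-measurable quantity may be held constant while the increment is integrated out,
since their joint law is a product. -/
lemma IsNoise.lintegral_comp_increment (hw : IsNoise P ℱ V w₀ w₁) {s t : T} (hst : s < t)
    {X : Type*} [MeasurableSpace X] {C : Ω → X} (hC : Measurable[ℱ s] C)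
    {f : X × (Fin n → CDC r) → ℝ≥0∞} (hf : Measurable f) :
    ∫⁻ ω, f (C ω, combine w₀ w₁ t ω - combine w₀ w₁ s ω) ∂P
      = ∫⁻ ω, ∫⁻ δ, f (C ω, δ)
          ∂(P.map fun ω => combine w₀ w₁ t ω - combine w₀ w₁ s ω) ∂P := by
  have hC' := hC.mono (ℱ.le s) le_rfl
  have hΔ : Measurable fun ω => combine w₀ w₁ t ω - combine w₀ w₁ s ω :=
    (hw.measurable t).sub (hw.measurable s)
  have := Measure.isProbabilityMeasure_map (μ := P) hΔ.aemeasurable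
  rw [← lintegral_map hf (hC'.prodMk hΔ), hw.map_prod_increment hst hC,
    lintegral_prod _ hf.aemeasurable, lintegral_map hf.lintegral_prod_right' hC']

lemma IsNoise.integral_comp_increment (hw : IsNoise P ℱ V w₀ w₁) {s t : T} (hst : s < t)
    {X : Type*} [MeasurableSpace X] {C : Ω → X} (hC : Measurable[ℱ s] C)
    {f : X × (Fin n → CDC r) → ℝ} (hf : Measurable f)
    (h0 : ∀ x, ∫ δ, f (x, δ) ∂(P.map fun ω => combine w₀ w₁ t ω - combine w₀ w₁ s ω) = 0) :
    ∫ ω, f (C ω, combine w₀ w₁ t ω - combine w₀ w₁ s ω) ∂P = 0 := by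
  have hC' := hC.mono (ℱ.le s) le_rfl
  have hΔ : Measurable fun ω => combine w₀ w₁ t ω - combine w₀ w₁ s ω :=
    (hw.measurable t).sub (hw.measurable s)
  have := Measure.isProbabilityMeasure_map (μ := P) hΔ.aemeasurable
  have := Measure.isProbabilityMeasure_map (μ := P) hC'.aemeasurable
  rw [← integral_map (hC'.prodMk hΔ).aemeasurable hf.aestronglyMeasurable,
    hw.map_prod_increment hst hC]
  -- Integrability is not assumed: if it fails, the Bochner integral is 0 by convention, which is
  -- the claimed value anyway.
  by_cases hi : Integrable f ((P.map C).prod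
      (P.map fun ω => combine w₀ w₁ t ω - combine w₀ w₁ s ω))
  · rw [integral_prod _ hi]
    simp_rw [h0]
    simp
  · exact integral_undef hi

lemma continuous_of_submodule {E G : Type*} [NormedAddCommGroup E] [NormedSpace ℝ E]
    [FiniteDimensional ℝ E] [NormedAddCommGroup G] [NormedSpace ℝ G] (W : Submodule ℝ E)
    (f : W →ₗ[ℝ] G) : Continuous fun x => f x :=
  f.continuous_of_finiteDimensional

lemma continuous_coeffMap (V : Fin 2 → Lr r n n) : Continuous fun S : Lr r n h => coeffMap V S :=
  continuous_of_submodule _ _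

lemma measurable_coeffMap (V : Fin 2 → Lr r n n) :
    Measurable fun S : Lr r n h => coeffMap V S :=
  (continuous_coeffMap V).measurable

lemma measurable_F (V : Fin 2 → Lr r n n) :
    Measurable fun S : Lr r n h => ENNReal.ofReal (F V S) := by
  simp_rw [F_eq_norm_sq]
  exact ((measurable_coeffMap V).norm.pow_const 2).ennreal_ofReal

/-- The Itô isometry for one step. It is stated with values in $[0,\infty]$, so no moment of the
coefficient need be finite. -/
lemma IsNoise.lintegral_norm_sq_apply (hw : IsNoise P ℱ V w₀ w₁) {s t : T} (hst : s < t)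
    {C : Ω → Lr r n h} (hC : Measurable[ℱ s] C) :
    ∫⁻ ω, ENNReal.ofReal (‖(WithLp.toLp 2
        ((C ω).1 (combine w₀ w₁ t ω - combine w₀ w₁ s ω)) : HSpace r h)‖ ^ 2) ∂P
      = ENNReal.ofReal ((t : ℝ) - s) * ∫⁻ ω, ENNReal.ofReal (F V (C ω)) ∂P := by
  rw [hw.lintegral_comp_increment hst hC
    (f := fun p => ENNReal.ofReal (‖(WithLp.toLp 2 (p.1.1 p.2) : HSpace r h)‖ ^ 2))
    (measurable_apply_pair.norm.pow_const 2).ennreal_ofReal]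
  simp_rw [hw.lintegral_norm_sq_apply_law hst.le]
  have hm : Measurable fun ω => ENNReal.ofReal (F V (C ω)) :=
    (measurable_F V).comp (hC.mono (ℱ.le s) le_rfl)
  rw [lintegral_const_mul _ hm]

/-- The martingale property in the form needed: a step is orthogonal to everything known at its left
end. -/
lemma IsNoise.integral_inner_apply (hw : IsNoise P ℱ V w₀ w₁) {s t : T} (hst : s < t)
    {C : Ω → Lr r n h} (hC : Measurable[ℱ s] C) {X : Ω → HSpace r h} (hX : Measurable[ℱ s] X) :
    ∫ ω, inner ℝ (X ω) (WithLp.toLp 2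
        ((C ω).1 (combine w₀ w₁ t ω - combine w₀ w₁ s ω)) : HSpace r h) ∂P = 0 :=
  hw.integral_comp_increment hst (hX.prodMk hC)
    (f := fun p => inner ℝ p.1.1 (WithLp.toLp 2 (p.1.2.1 p.2) : HSpace r h))
    ((measurable_fst.comp measurable_fst).inner
      (measurable_apply_pair.comp ((measurable_snd.comp measurable_fst).prodMk measurable_snd)))
    fun p => hw.integral_inner_apply_law hst.le p.2 p.1

end Increments

/-! ### The isometry for elementary random functions -/

lemma lintegral_norm_add_sq {Ω H : Type*} [MeasurableSpace Ω] {P : Measure Ω}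
    [NormedAddCommGroup H] [InnerProductSpace ℝ H] {X Y : Ω → H}
    (hX : MemLp X 2 P) (hY : MemLp Y 2 P) (h : ∫ ω, inner ℝ (X ω) (Y ω) ∂P = 0) :
    ∫⁻ ω, ENNReal.ofReal (‖X ω + Y ω‖ ^ 2) ∂P
      = ∫⁻ ω, ENNReal.ofReal (‖X ω‖ ^ 2) ∂P + ∫⁻ ω, ENNReal.ofReal (‖Y ω‖ ^ 2) ∂P := by
  have hi : ∀ {Z : Ω → H}, MemLp Z 2 P → Integrable (fun ω => ‖Z ω‖ ^ 2) P := fun hZ => by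
    exact_mod_cast hZ.integrable_norm_pow (by norm_num)
  have hXY : Integrable (fun ω => inner ℝ (X ω) (Y ω)) P :=
    (hX.norm.integrable_mul hY.norm).mono' (hX.1.inner hY.1)
      (ae_of_all _ fun ω => abs_real_inner_le_norm _ _)
  have hs : Integrable (fun ω => ‖X ω + Y ω‖ ^ 2) P := hi (hX.add hY)
  rw [← ofReal_integral_eq_lintegral_ofReal hs (ae_of_all _ fun _ => by positivity),
    ← ofReal_integral_eq_lintegral_ofReal (hi hX) (ae_of_all _ fun _ => by positivity),
    ← ofReal_integral_eq_lintegral_ofReal (hi hY) (ae_of_all _ fun _ => by positivity),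
    ← ENNReal.ofReal_add (by positivity) (by positivity)]
  congr 1
  simp_rw [norm_add_sq_real]
  have h2 := hXY.const_mul 2
  have h3 : Integrable (fun ω => ‖X ω‖ ^ 2 + 2 * inner ℝ (X ω) (Y ω)) P := (hi hX).add h2
  rw [integral_add h3 (hi hY), integral_add (hi hX) h2, integral_const_mul, h]
  ring

lemma memLp_two_of_lintegral_lt_top {Ω H : Type*} [MeasurableSpace Ω] {P : Measure Ω}
    [NormedAddCommGroup H] {X : Ω → H} (hX : AEStronglyMeasurable X P)
    (h : ∫⁻ ω, ENNReal.ofReal (‖X ω‖ ^ 2) ∂P < ∞) : MemLp X 2 P := by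
  refine (memLp_two_iff_integrable_sq_norm hX).2 ⟨(hX.norm.pow 2), ?_⟩
  rw [hasFiniteIntegral_iff_ofReal (ae_of_all _ fun _ => by positivity)]
  exact h

section Isometry

variable {r n h : ℕ} {Ω : Type*} [mΩ : MeasurableSpace Ω] {T : Set ℝ} {P : Measure Ω}
  {ℱ : Filtration T mΩ} {V : Fin 2 → Lr r n n} {w₀ w₁ : T → Ω → Fin n → CD r}

/-- The value of an operator at an increment of the noise, as an element of `HSpace`. -/
def stepTerm (w : T → Ω → Fin n → CDC r) (C : Ω → Lr r n h) (s t : T) (ω : Ω) : HSpace r h :=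
  WithLp.toLp 2 ((C ω).1 (w t ω - w s ω))

omit mΩ in
@[simp] lemma stepTerm_self (w : T → Ω → Fin n → CDC r) (C : Ω → Lr r n h) (s : T) (ω : Ω) :
    stepTerm w C s s ω = 0 := by
  simp [stepTerm]

lemma IsNoise.measurable_stepTerm (hw : IsNoise P ℱ V w₀ w₁) {C : Ω → Lr r n h} {s t u : T}
    (hst : s ≤ t) (htu : t ≤ u) (hC : s < t → Measurable[ℱ s] C) :
    Measurable[ℱ u] (stepTerm (combine w₀ w₁) C s t) := by
  rcases hst.eq_or_lt with rfl | hlt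
  · have : stepTerm (combine w₀ w₁) C s s = fun _ => 0 := by
      funext ω; simp
    rw [this]
    exact measurable_const
  · have h1 : Measurable[ℱ u] C := (hC hlt).mono (ℱ.mono (hst.trans htu)) le_rfl
    have h2 : Measurable[ℱ u] fun ω => combine w₀ w₁ t ω - combine w₀ w₁ s ω :=
      ((hw.adapted t).mono (ℱ.mono htu) le_rfl).sub
        ((hw.adapted s).mono (ℱ.mono (hst.trans htu)) le_rfl)
    exact measurable_apply_pair.comp (h1.prodMk h2)

variable [IsProbabilityMeasure P]

lemma IsNoise.lintegral_stepTerm (hw : IsNoise P ℱ V w₀ w₁) {C : Ω → Lr r n h} {s t : T}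
    (hst : s ≤ t) (hC : s < t → Measurable[ℱ s] C) :
    ∫⁻ ω, ENNReal.ofReal (‖stepTerm (combine w₀ w₁) C s t ω‖ ^ 2) ∂P
      = ENNReal.ofReal ((t : ℝ) - s) * ∫⁻ ω, ENNReal.ofReal (F V (C ω)) ∂P := by
  rcases hst.eq_or_lt with rfl | hlt
  · simp
  · exact hw.lintegral_norm_sq_apply hlt (hC hlt)

/-- Pythagoras by induction on the number of steps. Measurability of the partial sum at its final
time is carried along because it makes the next step orthogonal. Coefficients need be measurable
only over nondegenerate intervals, as truncating the times to $[\beta,\gamma]$ can collapse some of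
them. -/
lemma IsNoise.sum_stepTerm (hw : IsNoise P ℱ V w₀ w₁) : ∀ (N : ℕ) (s : Fin (N + 1) → T)
    (_ : Monotone s) (C : Fin N → Ω → Lr r n h)
    (_ : ∀ i, s i.castSucc < s i.succ → Measurable[ℱ (s i.castSucc)] (C i))
    (_ : ∀ i, ENNReal.ofReal ((s i.succ : ℝ) - s i.castSucc)
      * ∫⁻ ω, ENNReal.ofReal (F V (C i ω)) ∂P < ∞),
    Measurable[ℱ (s (Fin.last N))]
      (fun ω => ∑ i, stepTerm (combine w₀ w₁) (C i) (s i.castSucc) (s i.succ) ω) ∧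
    ∫⁻ ω, ENNReal.ofReal (‖∑ i, stepTerm (combine w₀ w₁) (C i) (s i.castSucc) (s i.succ) ω‖ ^ 2) ∂P
      = ∑ i, ENNReal.ofReal ((s i.succ : ℝ) - s i.castSucc)
          * ∫⁻ ω, ENNReal.ofReal (F V (C i ω)) ∂P
  | 0, s, _, C, _, _ => by
      simp
  | N + 1, s, hs, C, hC, hfin => by
      obtain ⟨hm, hI⟩ := hw.sum_stepTerm N (fun i => s i.castSucc)
        (hs.comp Fin.strictMono_castSucc.monotone) (fun i => C i.castSucc)
        (fun i => hC i.castSucc) (fun i => hfin i.castSucc)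
      have hle : s (Fin.last N).castSucc ≤ s (Fin.last N).succ := hs (Fin.castSucc_le_succ _)
      simp only [Fin.sum_univ_castSucc (n := N), Fin.succ_castSucc]
      have hfinN := hfin (Fin.last N)
      have hCN := hC (Fin.last N)
      have hmD := hw.measurable_stepTerm hle le_rfl hCN
      have hI2 := hw.lintegral_stepTerm hle hCN
      refine ⟨(hm.mono (ℱ.mono hle) le_rfl).add hmD, ?_⟩
      have hmem := memLp_two_of_lintegral_lt_top (P := P)
        (hm.mono (ℱ.le _) le_rfl).aestronglyMeasurable
        (by rw [hI]; exact ENNReal.sum_lt_top.2 fun i _ => hfin i.castSucc)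
      have hmem' := memLp_two_of_lintegral_lt_top (P := P)
        (hmD.mono (ℱ.le _) le_rfl).aestronglyMeasurable (by rw [hI2]; exact hfinN)
      rw [lintegral_norm_add_sq hmem hmem', hI, hI2]
      rcases hle.eq_or_lt with heq | hlt
      · rw [← heq]
        simp
      · exact hw.integral_inner_apply hlt (hCN hlt) hm

/-- An infinite term makes the right side infinite, so as an inequality the isometry needs no
finiteness. -/
lemma IsNoise.lintegral_sum_stepTerm_le (hw : IsNoise P ℱ V w₀ w₁) {N : ℕ} (s : Fin (N + 1) → T)
    (hs : Monotone s) (C : Fin N → Ω → Lr r n h)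
    (hC : ∀ i, s i.castSucc < s i.succ → Measurable[ℱ (s i.castSucc)] (C i)) :
    ∫⁻ ω, ENNReal.ofReal (‖∑ i, stepTerm (combine w₀ w₁) (C i) (s i.castSucc) (s i.succ) ω‖ ^ 2) ∂P
      ≤ ∑ i, ENNReal.ofReal ((s i.succ : ℝ) - s i.castSucc)
          * ∫⁻ ω, ENNReal.ofReal (F V (C i ω)) ∂P := by
  by_cases hfin : ∀ i, ENNReal.ofReal ((s i.succ : ℝ) - s i.castSucc)
      * ∫⁻ ω, ENNReal.ofReal (F V (C i ω)) ∂P < ∞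
  · exact (hw.sum_stepTerm N s hs C hC hfin).2.le
  · push Not at hfin
    obtain ⟨i, hi⟩ := hfin
    exact le_top.trans (hi.trans (Finset.single_le_sum
      (f := fun i => ENNReal.ofReal ((s i.succ : ℝ) - s i.castSucc)
      * ∫⁻ ω, ENNReal.ofReal (F V (C i ω)) ∂P) (fun _ _ => zero_le) (Finset.mem_univ i)))

end Isometry

/-! ### Refinements of elementary random functions -/

section Refinement

lemma add_neg_one_smul {M : Type*} [AddCommGroup M] [Module ℝ M] (x y : M) :
    x + (-1 : ℝ) • y = x - y := by
  rw [neg_one_smul, sub_eq_add_neg]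

/-- Telescoping up to the index $b$, written as a sum over all cells so that later sums can be
exchanged. -/
lemma sum_ite_succ_le {M : Type*} [AddCommGroup M] {N : ℕ} (g : Fin (N + 1) → M)
    (b : Fin (N + 1)) :
    ∑ i : Fin N, (if i.succ ≤ b then g i.succ - g i.castSucc else 0) = g b - g 0 := by
  induction b using Fin.induction with
  | zero => simp
  | succ b ih =>
    have h : ∀ i : Fin N, (if i.succ ≤ b.succ then g i.succ - g i.castSucc else 0)
        = (if i.succ ≤ b.castSucc then g i.succ - g i.castSucc else 0)
          + if i = b then g i.succ - g i.castSucc else 0 := by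
      intro i
      rcases lt_trichotomy i b with hi | hi | hi
      · simp [Fin.succ_le_castSucc_iff, hi, hi.le, hi.ne]
      · subst hi; simp [Fin.succ_le_castSucc_iff]
      · simp [Fin.succ_le_castSucc_iff, hi.not_ge, hi.ne', hi.le]
    simp_rw [h, Finset.sum_add_distrib, ih]
    simp

lemma sub_eq_sum_ite {ι M : Type*} [LinearOrder ι] [AddCommGroup M] {N : ℕ} {q : Fin (N + 1) → ι}
    (hq : StrictMono q) (f : ι → M) {a b : Fin (N + 1)} (hab : a ≤ b) :
    f (q b) - f (q a) = ∑ i : Fin N, (if q i.succ ∈ Set.Ioc (q a) (q b) then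
      f (q i.succ) - f (q i.castSucc) else 0) := by
  have h : f (q b) - f (q a) = (f (q b) - f (q 0)) - (f (q a) - f (q 0)) := by abel
  rw [h, ← sum_ite_succ_le (fun j => f (q j)) b, ← sum_ite_succ_le (fun j => f (q j)) a,
    ← Finset.sum_sub_distrib]
  refine Finset.sum_congr rfl fun i _ => ?_
  simp only [Set.mem_Ioc, hq.le_iff_le, hq.lt_iff_lt]
  by_cases h1 : i.succ ≤ a
  · simp [h1, h1.trans hab, h1.not_gt]
  · by_cases h2 : i.succ ≤ b <;> simp [h1, h2, not_le.1 h1]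

/-- Invariance under refinement for sums whose terms are increments of a time-dependent additive
map. One suitable `f` gives the values of an elementary function and another gives its integral. -/
lemma sum_sub_apply_eq {ι A M : Type*} [LinearOrder ι] [AddCommGroup A] [AddCommGroup M]
    {K N : ℕ} {t : Fin (K + 1) → ι} {q : Fin (N + 1) → ι} (ht : StrictMono t) (hq : StrictMono q)
    (hqt : ∀ l, ∃ i, q i = t l) (x : Fin K → A) (f : ι → A →+ M) :
    ∑ l, (f (t l.succ) - f (t l.castSucc)) (x l)
      = ∑ i : Fin N, (f (q i.succ) - f (q i.castSucc))
        (∑ l, (Set.Ioc (t l.castSucc) (t l.succ)).indicator (fun _ => x l) (q i.succ)) := by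
  have hl : ∀ l : Fin K, f (t l.succ) - f (t l.castSucc)
      = ∑ i : Fin N, (if q i.succ ∈ Set.Ioc (t l.castSucc) (t l.succ) then
        f (q i.succ) - f (q i.castSucc) else 0) := by
    intro l
    obtain ⟨a, ha⟩ := hqt l.castSucc
    obtain ⟨b, hb⟩ := hqt l.succ
    rw [← ha, ← hb]
    refine sub_eq_sum_ite hq f (hq.le_iff_le.1 ?_)
    rw [ha, hb]
    exact (ht Fin.castSucc_lt_succ).le
  simp_rw [hl, AddMonoidHom.finsetSum_apply]
  rw [Finset.sum_comm]
  refine Finset.sum_congr rfl fun i _ => ?_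
  rw [map_sum]
  refine Finset.sum_congr rfl fun l _ => ?_
  by_cases hm : q i.succ ∈ Set.Ioc (t l.castSucc) (t l.succ)
  · rw [if_pos hm, Set.indicator_of_mem hm]
  · rw [if_neg hm, Set.indicator_of_notMem hm, map_zero, AddMonoidHom.zero_apply]

variable {r n h : ℕ} {Ω : Type*} [mΩ : MeasurableSpace Ω] {T : Set ℝ} {ℱ : Filtration T mΩ}

namespace Elementary

/-- A strictly increasing sequence of times that contains the times of `S`. -/
def IsRefinement (S : Elementary ℱ r n h) {N : ℕ} (q : Fin (N + 1) → T) : Prop :=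
  StrictMono q ∧ ∀ l, ∃ i, q i = S.t l

lemma sum_eq_of_isRefinement (S : Elementary ℱ r n h) {N : ℕ} {q : Fin (N + 1) → T}
    (hq : S.IsRefinement q) {M : Type*} [AddCommGroup M] (f : T → Lr r n h →+ M) (ω : Ω) :
    ∑ l, (f (S.t l.succ) - f (S.t l.castSucc)) (S.coeff l ω)
      = ∑ i : Fin N, (f (q i.succ) - f (q i.castSucc)) (S.eval (q i.succ) ω) :=
  sum_sub_apply_eq S.t_mono hq.1 hq.2 _ f

lemma eval_eq_of_isRefinement (S : Elementary ℱ r n h) {N : ℕ} {q : Fin (N + 1) → T}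
    (hq : S.IsRefinement q) (τ : T) (ω : Ω) :
    S.eval τ ω = ∑ i : Fin N, (Set.Ioc (q i.castSucc) (q i.succ)).indicator
      (fun _ => S.eval (q i.succ) ω) τ := by
  -- As a function of $t$, this `f` jumps from zero to the identity at $\tau$, so its increment over
  -- $(a,b]$ is the indicator of $\tau\in(a,b]$.
  have key := S.sum_eq_of_isRefinement hq
    (fun t => if τ ≤ t then AddMonoidHom.id (Lr r n h) else 0) ω
  have hind : ∀ (a b : T) (x : Lr r n h), a ≤ b →
      ((if τ ≤ b then AddMonoidHom.id (Lr r n h) else 0)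
        - (if τ ≤ a then AddMonoidHom.id (Lr r n h) else 0)) x
      = (Set.Ioc a b).indicator (fun _ => x) τ := by
    intro a b x hab
    by_cases h1 : τ ≤ a
    · simp [h1, h1.trans hab, h1.not_gt]
    · by_cases h2 : τ ≤ b <;> simp [h1, h2, not_le.1 h1]
  rw [Finset.sum_congr rfl fun l _ => hind _ _ _ (S.t_mono Fin.castSucc_lt_succ).le,
    Finset.sum_congr rfl fun i _ => hind _ _ _ (hq.1 Fin.castSucc_lt_succ).le] at key
  exact key

lemma integral_eq_of_isRefinement (S : Elementary ℱ r n h) {N : ℕ} {q : Fin (N + 1) → T}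
    (hq : S.IsRefinement q) (w : T → Ω → Fin n → CDC r) (β γ : T) (ω : Ω) :
    S.integral w β γ ω = ∑ i : Fin N, (S.eval (q i.succ) ω).1
      (w (max β (min (q i.succ) γ)) ω - w (max β (min (q i.castSucc) γ)) ω) := by
  have key := S.sum_eq_of_isRefinement hq
    (fun t => (AddMonoidHom.mk' (fun A : Lr r n h => A.1 (w (max β (min t γ)) ω))
      fun _ _ => rfl : Lr r n h →+ (Fin h → CDC r))) ω
  simp only [integral, map_sub]
  exact key

lemma measurable_eval_of_isRefinement (S : Elementary ℱ r n h) {N : ℕ} {q : Fin (N + 1) → T}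
    (hq : S.IsRefinement q) (i : Fin N) : Measurable[ℱ (q i.castSucc)] (S.eval (q i.succ)) := by
  unfold eval
  refine Finset.measurable_fun_sum _ fun l _ => ?_
  by_cases hm : q i.succ ∈ Set.Ioc (S.t l.castSucc) (S.t l.succ)
  · simp only [Set.indicator_of_mem hm]
    obtain ⟨a, ha⟩ := hq.2 l.castSucc
    -- A right end $q_{i+1}$ strictly beyond the node $t_l$ has its left end $q_i$ at or beyond
    -- $t_l$, since $t_l$ is itself a node of the refinement.
    have h1 := hm.1
    rw [← ha, hq.1.lt_iff_lt] at h1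
    refine (S.meas l).mono (ℱ.mono ?_) le_rfl
    rw [← ha, hq.1.le_iff_le]
    exact Fin.le_castSucc_iff.2 h1
  · simp only [Set.indicator_of_notMem hm]
    exact measurable_const

/-- The union of the two time sets, enumerated increasingly. It still starts at 0, because both
sequences do. -/
lemma exists_isRefinement (S S' : Elementary ℱ r n h) :
    ∃ (N : ℕ) (q : Fin (N + 1) → T), (q 0 : ℝ) = 0 ∧ S.IsRefinement q ∧ S'.IsRefinement q := by
  classical
  set Q : Finset T := Finset.univ.image S.t ∪ Finset.univ.image S'.t with hQ
  have hmem : ∀ l, S.t l ∈ Q := fun l => by simp [hQ]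
  have hmem' : ∀ l, S'.t l ∈ Q := fun l => by simp [hQ]
  have hQ' : ∀ x ∈ Q, (∃ l, S.t l = x) ∨ ∃ l, S'.t l = x := fun x hx => by simpa [hQ] using hx
  have hcard : Q.card = (Q.card - 1) + 1 :=
    (Nat.succ_pred_eq_of_pos (Finset.card_pos.2 ⟨_, hmem 0⟩)).symm
  have hrange := Finset.range_orderEmbOfFin Q hcard
  have hex : ∀ x ∈ Q, ∃ i, Q.orderEmbOfFin hcard i = x := fun x hx => by
    have : x ∈ Set.range (Q.orderEmbOfFin hcard) := by rw [hrange]; exact hx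
    exact this
  refine ⟨Q.card - 1, Q.orderEmbOfFin hcard, ?_,
    ⟨(Q.orderEmbOfFin hcard).strictMono, fun l => hex _ (hmem l)⟩,
    ⟨(Q.orderEmbOfFin hcard).strictMono, fun l => hex _ (hmem' l)⟩⟩
  have h0 : S'.t 0 = S.t 0 := Subtype.ext (S'.t_zero.trans S.t_zero.symm)
  have hle : S.t 0 ≤ Q.orderEmbOfFin hcard 0 := by
    rcases hQ' _ (Q.orderEmbOfFin_mem hcard 0) with ⟨l, hl⟩ | ⟨l, hl⟩
    · rw [← hl]; exact S.t_mono.monotone (Fin.zero_le l)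
    · rw [← hl, ← h0]; exact S'.t_mono.monotone (Fin.zero_le l)
  obtain ⟨j, hj⟩ := hex _ (hmem 0)
  have hge : Q.orderEmbOfFin hcard 0 ≤ S.t 0 := by
    rw [← hj]; exact (Q.orderEmbOfFin hcard).monotone (Fin.zero_le j)
  rw [le_antisymm hge hle, S.t_zero]

/-- Linear combinations of elementary random functions are elementary. -/
lemma exists_add_smul (S S' : Elementary ℱ r n h) (c : ℝ) :
    ∃ D : Elementary ℱ r n h, (∀ τ ω, D.eval τ ω = S.eval τ ω + c • S'.eval τ ω) ∧
      ∀ (w : T → Ω → Fin n → CDC r) (β γ : T) (ω : Ω),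
        D.integral w β γ ω = S.integral w β γ ω + c • S'.integral w β γ ω := by
  obtain ⟨N, q, h0, hq, hq'⟩ := exists_isRefinement S S'
  let D : Elementary ℱ r n h :=
    { k := N
      t := q
      t_zero := h0
      t_mono := hq.1
      coeff := fun i ω => S.eval (q i.succ) ω + c • S'.eval (q i.succ) ω
      meas := fun i => (S.measurable_eval_of_isRefinement hq i).add
        ((S'.measurable_eval_of_isRefinement hq' i).const_smul c) }
  refine ⟨D, fun τ ω => ?_, fun w β γ ω => ?_⟩
  · rw [S.eval_eq_of_isRefinement hq, S'.eval_eq_of_isRefinement hq', Finset.smul_sum,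
      ← Finset.sum_add_distrib]
    refine Finset.sum_congr rfl fun i _ => ?_
    change (Set.Ioc (q i.castSucc) (q i.succ)).indicator
      (fun _ => S.eval (q i.succ) ω + c • S'.eval (q i.succ) ω) τ = _
    by_cases hm : τ ∈ Set.Ioc (q i.castSucc) (q i.succ)
    · simp only [Set.indicator_of_mem hm]
    · simp only [Set.indicator_of_notMem hm, smul_zero, add_zero]
  · rw [S.integral_eq_of_isRefinement hq, S'.integral_eq_of_isRefinement hq', Finset.smul_sum,
      ← Finset.sum_add_distrib]
    rfl

lemma exists_sub (S S' : Elementary ℱ r n h) :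
    ∃ D : Elementary ℱ r n h, (∀ τ ω, D.eval τ ω = S.eval τ ω - S'.eval τ ω) ∧
      ∀ (w : T → Ω → Fin n → CDC r) (β γ : T) (ω : Ω),
        D.integral w β γ ω = S.integral w β γ ω - S'.integral w β γ ω := by
  obtain ⟨D, h1, h2⟩ := exists_add_smul S S' (-1)
  exact ⟨D, fun τ ω => (h1 τ ω).trans (add_neg_one_smul (M := Lr r n h) _ _),
    fun w β γ ω => (h2 w β γ ω).trans (add_neg_one_smul (M := Fin h → CDC r) _ _)⟩

end Elementary

end Refinement

/-! ### The Lebesgue measure on the time set -/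

section TimeSet

variable {T : Set ℝ}

lemma IsTimeSet.measurableSet (hT : IsTimeSet T) : MeasurableSet T := by
  rcases hT with ⟨s, -, rfl⟩ | rfl
  · exact measurableSet_Icc
  · exact measurableSet_Ici

lemma IsTimeSet.ordConnected (hT : IsTimeSet T) : T.OrdConnected := by
  rcases hT with ⟨s, -, rfl⟩ | rfl
  · exact Set.ordConnected_Icc
  · exact Set.ordConnected_Ici

lemma IsTimeSet.nonneg (hT : IsTimeSet T) (t : T) : 0 ≤ (t : ℝ) := by
  obtain ⟨t, ht⟩ := t
  rcases hT with ⟨s, -, rfl⟩ | rfl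
  · exact ht.1
  · exact ht

lemma IsTimeSet.zero_mem (hT : IsTimeSet T) : (0 : ℝ) ∈ T := by
  rcases hT with ⟨s, hs, rfl⟩ | rfl
  · exact ⟨le_rfl, hs.le⟩
  · exact Set.mem_Ici.2 le_rfl

lemma IsTimeSet.lebesgue_apply (hT : IsTimeSet T) (A : Set T) :
    lebesgue T A = volume (Subtype.val '' A : Set ℝ) :=
  (MeasurableEmbedding.subtype_coe hT.measurableSet).comap_apply _ _

lemma IsTimeSet.lebesgue_Ioc (hT : IsTimeSet T) (u v : T) :
    lebesgue T (Set.Ioc u v) = ENNReal.ofReal ((v : ℝ) - u) := by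
  have := hT.ordConnected
  rw [hT.lebesgue_apply, ← Real.volume_Ioc]
  congr 1
  ext x
  simp only [Set.mem_image, Set.mem_Ioc]
  constructor
  · rintro ⟨y, hy, rfl⟩
    exact hy
  · intro hx
    exact ⟨⟨x, this.out u.2 v.2 ⟨hx.1.le, hx.2⟩⟩, hx, rfl⟩

lemma IsTimeSet.lebesgue_Icc_lt_top (hT : IsTimeSet T) (u v : T) :
    lebesgue T (Set.Icc u v) < ∞ := by
  rw [hT.lebesgue_apply]
  refine (measure_mono (t := Set.Icc (u : ℝ) v) ?_).trans_lt measure_Icc_lt_top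
  rintro _ ⟨y, hy, rfl⟩
  exact hy

lemma IsTimeSet.lebesgue_singleton (hT : IsTimeSet T) (u : T) : lebesgue T {u} = 0 := by
  rw [hT.lebesgue_apply]
  simp

lemma IsTimeSet.isFiniteMeasure (hT : IsTimeSet T) (u v : T) :
    IsFiniteMeasure ((lebesgue T).restrict (Set.Icc u v)) :=
  ⟨by rw [Measure.restrict_apply_univ]; exact hT.lebesgue_Icc_lt_top u v⟩

lemma IsTimeSet.sigmaFinite (hT : IsTimeSet T) : SigmaFinite (lebesgue T) := by
  refine ⟨⟨⟨fun N => (Subtype.val ⁻¹' Set.Icc (-(N : ℝ)) N), fun _ => trivial, fun N => ?_, ?_⟩⟩⟩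
  · rw [hT.lebesgue_apply]
    refine (measure_mono (t := Set.Icc (-(N : ℝ)) N) ?_).trans_lt measure_Icc_lt_top
    rintro _ ⟨y, hy, rfl⟩
    exact hy
  · refine Set.eq_univ_of_forall fun x => ?_
    obtain ⟨N, hN⟩ := exists_nat_ge |(x : ℝ)|
    exact Set.mem_iUnion.2 ⟨N, abs_le.1 hN⟩

end TimeSet

/-! ### Energy of elementary random functions and the bound on their integrals -/

section Energy

/-- At most one indicator is active at a point, so `φ` need not be additive; it will be the
quadratic $F$. -/
lemma apply_sum_indicator {ι α A B : Type*} [AddCommMonoid A] [AddCommMonoid B] (s : Finset ι)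
    (D : ι → Set α) (hD : Pairwise (Function.onFun Disjoint D)) (x : ι → A) (φ : A → B)
    (h0 : φ 0 = 0) (a : α) :
    φ (∑ l ∈ s, (D l).indicator (fun _ => x l) a)
      = ∑ l ∈ s, (D l).indicator (fun _ => φ (x l)) a := by
  by_cases h : ∃ l ∈ s, a ∈ D l
  · obtain ⟨l, hl, ha⟩ := h
    have hne : ∀ l' ∈ s, l' ≠ l → a ∉ D l' := fun l' _ hl' ha' =>
      Set.disjoint_left.1 (hD hl') ha' ha
    rw [Finset.sum_eq_single_of_mem l hl fun l' h1 h2 => Set.indicator_of_notMem (hne l' h1 h2) _,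
      Finset.sum_eq_single_of_mem l hl fun l' h1 h2 => Set.indicator_of_notMem (hne l' h1 h2) _,
      Set.indicator_of_mem ha, Set.indicator_of_mem ha]
  · push Not at h
    rw [Finset.sum_eq_zero fun l hl => Set.indicator_of_notMem (h l hl) _,
      Finset.sum_eq_zero fun l hl => Set.indicator_of_notMem (h l hl) _, h0]

variable {r n h : ℕ} {Ω : Type*} [mΩ : MeasurableSpace Ω] {T : Set ℝ} {P : Measure Ω}
  {ℱ : Filtration T mΩ} {V : Fin 2 → Lr r n n} {w₀ w₁ : T → Ω → Fin n → CD r}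

namespace Elementary

lemma pairwise_disjoint_Ioc (S : Elementary ℱ r n h) :
    Pairwise (Function.onFun Disjoint fun l : Fin S.k =>
      Set.Ioc (S.t l.castSucc) (S.t l.succ)) := by
  intro i j hij
  wlog hlt : i < j generalizing i j
  · exact (this hij.symm (lt_of_le_of_ne (not_lt.1 hlt) hij.symm)).symm
  refine Set.disjoint_left.2 fun x hx hx' => ?_
  exact absurd (hx.2.trans (S.t_mono.monotone (Fin.succ_le_castSucc_iff.2 hlt))) hx'.1.not_ge

lemma energy_eval (S : Elementary ℱ r n h) (V : Fin 2 → Lr r n n) (β γ : T) :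
    energy P V β γ S.eval = ∑ l : Fin S.k,
      lebesgue T (Set.Ioc (S.t l.castSucc) (S.t l.succ) ∩ Set.Icc β γ)
        * ∫⁻ ω, ENNReal.ofReal (F V (S.coeff l ω)) ∂P := by
  have hF0 : ENNReal.ofReal (F V (0 : Lr r n h)) = 0 := by
    rw [F_eq_norm_sq]; simp
  have hF : ∀ τ ω, ENNReal.ofReal (F V (S.eval τ ω))
      = ∑ l : Fin S.k, (Set.Ioc (S.t l.castSucc) (S.t l.succ)).indicator
        (fun _ => ENNReal.ofReal (F V (S.coeff l ω))) τ := fun τ ω =>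
    apply_sum_indicator Finset.univ (fun l : Fin S.k => Set.Ioc (S.t l.castSucc) (S.t l.succ))
      S.pairwise_disjoint_Ioc (fun l => S.coeff l ω)
      (fun A : Lr r n h => ENNReal.ofReal (F V A)) hF0 τ
  have hm : ∀ l : Fin S.k, Measurable fun ω => ENNReal.ofReal (F V (S.coeff l ω)) := fun l =>
    (measurable_F V).comp ((S.meas l).mono (ℱ.le _) le_rfl)
  unfold energy
  simp_rw [hF]
  have hin : ∀ ω, ∫⁻ τ in Set.Icc β γ, (∑ l : Fin S.k,
        (Set.Ioc (S.t l.castSucc) (S.t l.succ)).indicator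
        (fun _ => ENNReal.ofReal (F V (S.coeff l ω))) τ) ∂(lebesgue T)
      = ∑ l : Fin S.k, lebesgue T (Set.Ioc (S.t l.castSucc) (S.t l.succ) ∩ Set.Icc β γ)
        * ENNReal.ofReal (F V (S.coeff l ω)) := by
    intro ω
    rw [lintegral_finsetSum _ fun l _ => measurable_const.indicator measurableSet_Ioc]
    refine Finset.sum_congr rfl fun l _ => ?_
    rw [lintegral_indicator_const measurableSet_Ioc, Measure.restrict_apply measurableSet_Ioc,
      mul_comm]
  simp_rw [hin]
  rw [lintegral_finsetSum _ fun l _ => (hm l).const_mul _]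
  refine Finset.sum_congr rfl fun l _ => ?_
  rw [lintegral_const_mul _ (hm l)]

end Elementary

variable [IsProbabilityMeasure P]

/-- The isometry along the truncated times $\beta\vee(t_i\wedge\gamma)$, whose cells lie in
$(t_i,t_{i+1}]\cap[\beta,\gamma]$. The 2 is the weight in `normSq`. -/
lemma IsNoise.lintegral_normSq_integral_le (hw : IsNoise P ℱ V w₀ w₁) (hT : IsTimeSet T)
    (S : Elementary ℱ r n h) {β γ : T} (hβγ : β ≤ γ) :
    ∫⁻ ω, ENNReal.ofReal (normSq (S.integral (combine w₀ w₁) β γ ω)) ∂P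
      ≤ 2 * energy P V β γ S.eval := by
  set c : Fin (S.k + 1) → T := fun i => max β (min (S.t i) γ) with hc
  have hcm : Monotone c := fun i j hij =>
    max_le_max le_rfl (min_le_min (S.t_mono.monotone hij) le_rfl)
  have hmeas : ∀ i : Fin S.k, c i.castSucc < c i.succ →
      Measurable[ℱ (c i.castSucc)] (S.coeff i) := by
    intro i hi
    refine (S.meas i).mono (ℱ.mono ?_) le_rfl
    -- The truncated time can lie before $t_i$ only when $t_i$ is at or beyond $\gamma$, and then
    -- the truncated cell is degenerate.
    by_contra! hlt
    have h1 : γ ≤ S.t i.castSucc := by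
      by_contra! h2
      exact absurd ((min_eq_left h2.le).ge.trans (le_max_right β _)) hlt.not_ge
    have h2 : c i.castSucc = γ := by simp [hc, min_eq_right h1, hβγ]
    have h3 : c i.succ ≤ γ := max_le hβγ (min_le_right _ _)
    exact absurd (h3.trans h2.ge) hi.not_ge
  have hI := hw.lintegral_sum_stepTerm_le c hcm S.coeff hmeas
  have hnorm : ∀ ω, ENNReal.ofReal (normSq (S.integral (combine w₀ w₁) β γ ω))
      = 2 * ENNReal.ofReal (‖∑ i, stepTerm (combine w₀ w₁) (S.coeff i) (c i.castSucc)
        (c i.succ) ω‖ ^ 2) := by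
    intro ω
    rw [normSq_eq, ENNReal.ofReal_mul (by norm_num)]
    congr 1
    · simp
    · rw [Elementary.integral, WithLp.toLp_sum]
      rfl
  simp_rw [hnorm]
  rw [lintegral_const_mul' _ _ (by simp), S.energy_eval]
  refine mul_le_mul_right (hI.trans (Finset.sum_le_sum fun i _ => ?_)) 2
  refine mul_le_mul_left ?_ _
  rw [← hT.lebesgue_Ioc]
  refine measure_mono fun τ hτ => ?_
  have hβ : β < τ := (le_max_left _ _).trans_lt hτ.1
  have hmin : τ ≤ min (S.t i.succ) γ := (le_max_iff.1 hτ.2).resolve_left hβ.not_ge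
  have hγ : τ ≤ γ := hmin.trans (min_le_right _ _)
  have hlow : min (S.t i.castSucc) γ < τ := (le_max_right _ _).trans_lt hτ.1
  exact ⟨⟨(min_lt_iff.1 hlow).resolve_right hγ.not_gt, hmin.trans (min_le_left _ _)⟩, hβ.le, hγ⟩

end Energy

/-! ### Mean square approximation -/

section Approximation

lemma lintegral_ofReal_norm_sq {α H : Type*} [MeasurableSpace α] [NormedAddCommGroup H]
    (μ : Measure α) (g : α → H) :
    ∫⁻ x, ENNReal.ofReal (‖g x‖ ^ 2) ∂μ = eLpNorm g 2 μ ^ 2 := by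
  have h := eLpNorm_nnreal_pow_eq_lintegral (p := 2) (f := g) (μ := μ) (by norm_num)
  have h2 : (((2 : NNReal) : ℝ≥0∞)) = 2 := by norm_num
  rw [h2] at h
  simp only [NNReal.coe_ofNat, ENNReal.rpow_ofNat] at h
  rw [h]
  refine lintegral_congr fun x => ?_
  rw [ENNReal.ofReal_pow (norm_nonneg _), ofReal_norm]

variable {α X H : Type*} [m : MeasurableSpace α] {μ : Measure α} [NormedAddCommGroup X]
  [NormedSpace ℝ X] [FiniteDimensional ℝ X] [MeasurableSpace X] [BorelSpace X]
  [NormedAddCommGroup H] [NormedSpace ℝ H]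

/-- `f` is approximated in mean square by functions with the property `Q`. -/
def Approximable (μ : Measure α) (Q : (α → X) → Prop) (f : α → X) : Prop :=
  ∀ ε : ℝ≥0∞, ε ≠ 0 → ∃ g, eLpNorm (g - f) 2 μ ≤ ε ∧ Q g

omit [NormedSpace ℝ X] [FiniteDimensional ℝ X] [BorelSpace X] [MeasurableSpace X] in
lemma Approximable.add {Q : (α → X) → Prop} (hadd : ∀ f g, Q f → Q g → Q (f + g))
    (hmeas : ∀ f, Q f → AEStronglyMeasurable f μ) {f g : α → X}
    (hf : Approximable μ Q f) (hg : Approximable μ Q g) (hfm : AEStronglyMeasurable f μ)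
    (hgm : AEStronglyMeasurable g μ) : Approximable μ Q (f + g) := by
  intro ε hε
  obtain ⟨f', h1, h1'⟩ := hf (ε / 2) (by simpa using hε)
  obtain ⟨g', h2, h2'⟩ := hg (ε / 2) (by simpa using hε)
  refine ⟨f' + g', ?_, hadd _ _ h1' h2'⟩
  rw [add_sub_add_comm]
  refine (eLpNorm_add_le ((hmeas _ h1').sub hfm) ((hmeas _ h2').sub hgm) (by norm_num)).trans ?_
  exact (add_le_add h1 h2).trans (ENNReal.add_halves ε).le

omit [NormedSpace ℝ X] [FiniteDimensional ℝ X] [BorelSpace X] [MeasurableSpace X] in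
lemma Approximable.sub {Q : (α → X) → Prop} (hsub : ∀ f g, Q f → Q g → Q (f - g))
    (hmeas : ∀ f, Q f → AEStronglyMeasurable f μ) {f g : α → X}
    (hf : Approximable μ Q f) (hg : Approximable μ Q g) (hfm : AEStronglyMeasurable f μ)
    (hgm : AEStronglyMeasurable g μ) : Approximable μ Q (f - g) := by
  intro ε hε
  obtain ⟨f', h1, h1'⟩ := hf (ε / 2) (by simpa using hε)
  obtain ⟨g', h2, h2'⟩ := hg (ε / 2) (by simpa using hε)
  refine ⟨f' - g', ?_, hsub _ _ h1' h2'⟩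
  rw [sub_sub_sub_comm]
  refine (eLpNorm_sub_le ((hmeas _ h1').sub hfm) ((hmeas _ h2').sub hgm) (by norm_num)).trans ?_
  exact (add_le_add h1 h2).trans (ENNReal.add_halves ε).le

omit [NormedSpace ℝ X] [FiniteDimensional ℝ X] [BorelSpace X] [MeasurableSpace X] in
lemma Approximable.of_ae_eq {Q : (α → X) → Prop} {f : α → X} (h : ∃ g, Q g ∧ g =ᵐ[μ] f) :
    Approximable μ Q f := by
  intro ε _
  obtain ⟨g, hg, hgf⟩ := h
  refine ⟨g, ?_, hg⟩
  have h0 : g - f =ᵐ[μ] 0 := by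
    filter_upwards [hgf] with x hx
    simp [hx]
  rw [eLpNorm_congr_ae h0]
  simp

omit [NormedSpace ℝ X] [FiniteDimensional ℝ X] [BorelSpace X] [MeasurableSpace X] in
-- Dynkin's $\pi$-$\lambda$ argument: complements are differences from a constant. For a disjoint
-- union the finite partial sums suffice, since the measure of the tail tends to zero for a finite
-- measure.
lemma approximable_indicator [IsFiniteMeasure μ] {C : Set (Set α)}
    (hgen : m = MeasurableSpace.generateFrom C) (hpi : IsPiSystem C) {Q : (α → X) → Prop}
    (hadd : ∀ f g, Q f → Q g → Q (f + g)) (hsub : ∀ f g, Q f → Q g → Q (f - g))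
    (hmeas : ∀ f, Q f → AEStronglyMeasurable f μ)
    (huniv : ∀ c : X, ∃ g, Q g ∧ g =ᵐ[μ] fun _ => c)
    (hC : ∀ s ∈ C, ∀ c : X, ∃ g, Q g ∧ g =ᵐ[μ] s.indicator fun _ => c)
    (c : X) {s : Set α} (hs : MeasurableSet s) :
    Approximable μ Q (s.indicator fun _ => c) := by
  have hsm : ∀ {t : Set α}, MeasurableSet t →
      AEStronglyMeasurable (t.indicator fun _ => c) μ := fun ht =>
    aestronglyMeasurable_const.indicator ht
  have hzero : Approximable μ Q (0 : α → X) := .of_ae_eq (huniv 0)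
  induction s, hs using MeasurableSpace.induction_on_inter hgen hpi with
  | empty => rw [Set.indicator_empty]; exact hzero
  | basic t ht => exact .of_ae_eq (hC t ht c)
  | compl t ht ih =>
    rw [Set.indicator_compl]
    exact Approximable.sub hsub hmeas (.of_ae_eq (huniv c)) ih aestronglyMeasurable_const (hsm ht)
  | iUnion f hd hf ih =>
    have hpart : ∀ N : ℕ, Approximable μ Q (∑ i ∈ Finset.range N, (f i).indicator fun _ => c) ∧
        AEStronglyMeasurable (∑ i ∈ Finset.range N, (f i).indicator fun _ => c) μ := by
      intro N
      induction N with
      | zero => simpa using ⟨hzero, aestronglyMeasurable_zero⟩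
      | succ N ihN =>
        rw [Finset.sum_range_succ]
        exact ⟨Approximable.add hadd hmeas ihN.1 (ih N) ihN.2 (hsm (hf N)), ihN.2.add (hsm (hf N))⟩
    have hdiff : ∀ N : ℕ, (∑ i ∈ Finset.range N, (f i).indicator fun _ => c)
        - (⋃ i, f i).indicator (fun _ => c) = -(⋃ i ∈ Set.Ici N, f i).indicator fun _ => c := by
      intro N
      funext x
      simp only [Pi.sub_apply, Finset.sum_apply, Pi.neg_apply]
      by_cases hx : x ∈ ⋃ i, f i
      · obtain ⟨j, hj⟩ := Set.mem_iUnion.1 hx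
        have hne : ∀ i, i ≠ j → x ∉ f i := fun i hij hi => Set.disjoint_left.1 (hd hij) hi hj
        rw [Set.indicator_of_mem hx]
        by_cases hjN : j < N
        · have hnot : x ∉ ⋃ i ∈ Set.Ici N, f i := by
            simp only [Set.mem_iUnion, not_exists]
            intro i hi hxi
            have := hne i (fun h => by subst h; exact absurd hjN (not_lt.2 hi))
            exact this hxi
          rw [Set.indicator_of_notMem hnot, Finset.sum_eq_single_of_mem j (Finset.mem_range.2 hjN)
            fun i _ hi => Set.indicator_of_notMem (hne i hi) _, Set.indicator_of_mem hj]
          simp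
        · have hmem : x ∈ ⋃ i ∈ Set.Ici N, f i := by
            simp only [Set.mem_iUnion]
            exact ⟨j, not_lt.1 hjN, hj⟩
          rw [Set.indicator_of_mem hmem, Finset.sum_eq_zero fun i hi => Set.indicator_of_notMem
            (hne i fun h => by subst h; exact hjN (Finset.mem_range.1 hi)) _]
          simp
      · have hnot : ∀ i, x ∉ f i := fun i hi => hx (Set.mem_iUnion.2 ⟨i, hi⟩)
        have hnot' : x ∉ ⋃ i ∈ Set.Ici N, f i := by
          simp only [Set.mem_iUnion, not_exists]
          exact fun i _ => hnot i
        rw [Set.indicator_of_notMem hx, Set.indicator_of_notMem hnot',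
          Finset.sum_eq_zero fun i _ => Set.indicator_of_notMem (hnot i) _]
        simp
    have hlim : Tendsto (fun N : ℕ => eLpNorm ((∑ i ∈ Finset.range N, (f i).indicator fun _ => c)
        - (⋃ i, f i).indicator (fun _ => c)) 2 μ) atTop (𝓝 0) := by
      have h0 := tendsto_measure_biUnion_Ici_zero_of_pairwise_disjoint (μ := μ)
        (fun i => (hf i).nullMeasurableSet) hd
      have h1 : Tendsto (fun N : ℕ => ‖c‖ₑ * μ (⋃ i ∈ Set.Ici N, f i) ^ (1 / (2 : ℝ≥0∞).toReal))
          atTop (𝓝 (‖c‖ₑ * 0 ^ (1 / (2 : ℝ≥0∞).toReal))) :=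
        ENNReal.Tendsto.const_mul ((ENNReal.continuous_rpow_const.tendsto _).comp h0)
          (Or.inr enorm_ne_top)
      rw [ENNReal.zero_rpow_of_pos (by norm_num), mul_zero] at h1
      refine h1.congr fun N => ?_
      rw [hdiff, eLpNorm_neg, eLpNorm_indicator_const
        (MeasurableSet.biUnion (Set.to_countable _) fun i _ => hf i) (by norm_num) (by norm_num)]
    intro ε hε
    have hε2 : (0 : ℝ≥0∞) < ε / 2 := by simpa [pos_iff_ne_zero] using hε
    obtain ⟨N, hN⟩ := (hlim.eventually (gt_mem_nhds hε2)).exists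
    obtain ⟨g, hg, hQ⟩ := (hpart N).1 (ε / 2) hε2.ne'
    refine ⟨g, ?_, hQ⟩
    rw [← sub_add_sub_cancel g (∑ i ∈ Finset.range N, (f i).indicator fun _ => c)]
    refine (eLpNorm_add_le ((hmeas _ hQ).sub (hpart N).2)
      ((hpart N).2.sub (hsm (MeasurableSet.iUnion hf))) (by norm_num)).trans ?_
    exact (add_le_add hg hN.le).trans (ENNReal.add_halves ε).le

/-- Functions that are square integrable after composition with a linear map `L` are approximated
by functions with the property `Q`, if `Q` holds for linear combinations of the indicators of a
generating `π`-system. -/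
lemma exists_approx_of_generateFrom [IsFiniteMeasure μ] {C : Set (Set α)}
    (hgen : m = MeasurableSpace.generateFrom C) (hpi : IsPiSystem C) {Q : (α → X) → Prop}
    (hadd : ∀ f g, Q f → Q g → Q (f + g)) (hsub : ∀ f g, Q f → Q g → Q (f - g))
    (hmeas : ∀ f, Q f → Measurable f)
    (huniv : ∀ c : X, ∃ g, Q g ∧ g =ᵐ[μ] fun _ => c)
    (hC : ∀ s ∈ C, ∀ c : X, ∃ g, Q g ∧ g =ᵐ[μ] s.indicator fun _ => c)
    (L : X →ₗ[ℝ] H) {f : α → X} (hf : Measurable f)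
    (hL : ∫⁻ x, ENNReal.ofReal (‖L (f x)‖ ^ 2) ∂μ < ∞) {ε : ℝ≥0∞} (hε : ε ≠ 0) :
    ∃ g, Q g ∧ eLpNorm (fun x => L (f x - g x)) 2 μ ≤ ε := by
  have := FiniteDimensional.proper_real X
  have hLc : Continuous L := L.continuous_of_finiteDimensional
  have hm' : ∀ g : α → X, Measurable g → AEStronglyMeasurable (fun x => L (g x)) μ := fun g hg =>
    hLc.comp_aestronglyMeasurable hg.aestronglyMeasurable
  have hmeas' : ∀ f, Q f → AEStronglyMeasurable f μ := fun f hf => (hmeas f hf).aestronglyMeasurable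
  -- `L` may have a kernel, so `f` itself need not be square integrable. Its truncations are
  -- bounded, and the error $L(f-f_N)$ is dominated by $Lf$.
  set fN : ℕ → α → X := fun N => {x | ‖f x‖ ≤ N}.indicator f with hfN
  have hset : ∀ N : ℕ, MeasurableSet {x | ‖f x‖ ≤ N} := fun N =>
    measurableSet_le hf.norm measurable_const
  have hfNm : ∀ N, Measurable (fN N) := fun N => hf.indicator (hset N)
  have hlim : Tendsto (fun N : ℕ => ∫⁻ x, ENNReal.ofReal (‖L (f x - fN N x)‖ ^ 2) ∂μ) atTop
      (𝓝 0) := by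
    have h0 : ∫⁻ _, (0 : ℝ≥0∞) ∂μ = 0 := by simp
    rw [← h0]
    refine tendsto_lintegral_of_dominated_convergence'
      (fun x => ENNReal.ofReal (‖L (f x)‖ ^ 2)) (fun N => ?_) (fun N => ?_) hL.ne ?_
    · exact ((hm' _ (hf.sub (hfNm N))).norm.aemeasurable.pow_const 2).ennreal_ofReal
    · refine ae_of_all _ fun x => ?_
      by_cases hx : x ∈ {x | ‖f x‖ ≤ N}
      · simp [hfN, Set.indicator_of_mem hx]
      · simp [hfN, Set.indicator_of_notMem hx]
    · refine ae_of_all _ fun x => ?_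
      obtain ⟨N₀, hN₀⟩ := exists_nat_ge ‖f x‖
      refine tendsto_const_nhds.congr' ?_
      filter_upwards [eventually_ge_atTop N₀] with N hN
      have hx : x ∈ {x | ‖f x‖ ≤ N} := hN₀.trans (by exact_mod_cast hN)
      simp [hfN, Set.indicator_of_mem hx]
  have hε2 : (0 : ℝ≥0∞) < ε / 2 := by simpa [pos_iff_ne_zero] using hε
  obtain ⟨N, hN⟩ := (hlim.eventually (gt_mem_nhds (ENNReal.pow_pos hε2 2))).exists
  rw [lintegral_ofReal_norm_sq] at hN
  have hN' : eLpNorm (fun x => L (f x - fN N x)) 2 μ ≤ ε / 2 :=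
    le_of_not_gt fun h => absurd hN (pow_le_pow_left' h.le 2).not_gt
  have hmem : MemLp (fN N) 2 μ := by
    refine MemLp.of_bound (hfNm N).aestronglyMeasurable N (ae_of_all _ fun x => ?_)
    by_cases hx : x ∈ {x | ‖f x‖ ≤ N}
    · rw [hfN]
      simp only [Set.indicator_of_mem hx]
      exact hx
    · simp [hfN, Set.indicator_of_notMem hx]
  obtain ⟨K, hK0, hK⟩ : ∃ K : NNReal, 0 < K ∧ ∀ x, ‖L x‖ ≤ K * ‖x‖ := by
    -- Adding 1 keeps the constant positive even when $L=0$.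
    refine ⟨‖LinearMap.toContinuousLinearMap L‖₊ + 1, by positivity, fun x => ?_⟩
    have h1 := (LinearMap.toContinuousLinearMap L).le_opNorm x
    have h2 := norm_nonneg x
    simp only [NNReal.coe_add, coe_nnnorm, NNReal.coe_one, add_mul, one_mul]
    exact h1.trans (le_add_of_nonneg_right h2)
  -- Density in $L^2$ is applied to the truncation with tolerance $\varepsilon/(2K)$, so that
  -- applying `L` costs at most $\varepsilon/2$.
  have hδ : ε / 2 / K ≠ 0 := by
    simp [hε]
  obtain ⟨g, hg, hQ⟩ := MemLp.induction_dense (p := 2) (μ := μ) (by norm_num) Q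
    (fun c s hs _ ε hε => approximable_indicator hgen hpi hadd hsub hmeas' huniv hC c hs ε hε)
    hadd hmeas' hmem hδ
  refine ⟨g, hQ, ?_⟩
  have hsplit : (fun x => L (f x - g x)) =
      (fun x => L (f x - fN N x)) + fun x => L ((fN N - g) x) := by
    funext x
    simp only [Pi.add_apply, Pi.sub_apply, ← map_add]
    congr 1
    abel
  rw [hsplit]
  refine (eLpNorm_add_le (hm' _ (hf.sub (hfNm N))) (hm' _ ((hfNm N).sub (hmeas _ hQ)))
    (by norm_num)).trans ?_
  have hb : eLpNorm (fun x => L ((fN N - g) x)) 2 μ ≤ ε / 2 := by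
    refine (eLpNorm_le_nnreal_smul_eLpNorm_of_ae_le_mul (g := fN N - g) (c := K)
      (ae_of_all _ fun x => ?_) 2).trans ?_
    · exact hK _
    · rw [ENNReal.smul_def, smul_eq_mul]
      exact (mul_le_mul_right hg _).trans ENNReal.mul_div_le
  exact (add_le_add hN' hb).trans (ENNReal.add_halves ε).le

end Approximation

/-! ### Approximation of predictable random functions -/

section Predictable

lemma exists_approx_of_submodule {α E H : Type*} [m : MeasurableSpace α] {μ : Measure α}
    [IsFiniteMeasure μ] [NormedAddCommGroup E] [NormedSpace ℝ E] [FiniteDimensional ℝ E]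
    [MeasurableSpace E] [BorelSpace E] [NormedAddCommGroup H] [NormedSpace ℝ H]
    (W : Submodule ℝ E) {C : Set (Set α)}
    (hgen : m = MeasurableSpace.generateFrom C) (hpi : IsPiSystem C) {Q : (α → W) → Prop}
    (hadd : ∀ f g, Q f → Q g → Q (f + g)) (hsub : ∀ f g, Q f → Q g → Q (f - g))
    (hmeas : ∀ f, Q f → Measurable f)
    (huniv : ∀ c : W, ∃ g, Q g ∧ g =ᵐ[μ] fun _ => c)
    (hC : ∀ s ∈ C, ∀ c : W, ∃ g, Q g ∧ g =ᵐ[μ] s.indicator fun _ => c)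
    (L : W →ₗ[ℝ] H) {f : α → W} (hf : Measurable f)
    (hL : ∫⁻ x, ENNReal.ofReal (‖L (f x)‖ ^ 2) ∂μ < ∞) {ε : ℝ≥0∞} (hε : ε ≠ 0) :
    ∃ g, Q g ∧ eLpNorm (fun x => L (f x - g x)) 2 μ ≤ ε :=
  exists_approx_of_generateFrom hgen hpi hadd hsub hmeas huniv hC L hf hL hε

variable {r n h : ℕ} {Ω : Type*} [mΩ : MeasurableSpace Ω] {T : Set ℝ} {P : Measure Ω}
  {ℱ : Filtration T mΩ} {V : Fin 2 → Lr r n n}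

lemma predictableSigma_le (ℱ : Filtration T mΩ) :
    predictableSigma ℱ ≤ (Prod.instMeasurableSpace : MeasurableSpace (T × Ω)) := by
  refine MeasurableSpace.generateFrom_le ?_
  rintro s (⟨v, t, A, -, hA, rfl⟩ | ⟨z, A, -, hA, rfl⟩)
  · exact measurableSet_Ioc.prod (ℱ.le v _ hA)
  · exact (measurableSet_singleton z).prod (ℱ.le z _ hA)

lemma measurableSet_predictableSigma_Ioc {v t : T} (hvt : v < t) {A : Set Ω}
    (hA : MeasurableSet[ℱ v] A) : MeasurableSet[predictableSigma ℱ] (Set.Ioc v t ×ˢ A) :=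
  MeasurableSpace.measurableSet_generateFrom (Or.inl ⟨v, t, A, hvt, hA, rfl⟩)

/-- Preimages are rectangles or complements of rectangles, according to whether the default value 0
lies in the target set. -/
lemma measurable_indicator_Ioc {X : Type*} [MeasurableSpace X] [Zero X] {v t : T} (hvt : v < t)
    {C : Ω → X} (hC : Measurable[ℱ v] C) :
    Measurable[predictableSigma ℱ]
      (fun q : T × Ω => (Set.Ioc v t).indicator (fun _ => C q.2) q.1) := by
  intro B hB
  by_cases h0 : (0 : X) ∈ B
  · have : (fun q : T × Ω => (Set.Ioc v t).indicator (fun _ => C q.2) q.1) ⁻¹' B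
        = (Set.Ioc v t ×ˢ (C ⁻¹' Bᶜ))ᶜ := by
      ext ⟨τ, ω⟩
      by_cases hτ : τ ∈ Set.Ioc v t
      · simp only [Set.mem_preimage, Set.indicator_of_mem hτ, Set.mem_compl_iff, Set.mem_prod, hτ,
          true_and, not_not]
      · simp only [Set.mem_preimage, Set.indicator_of_notMem hτ, Set.mem_compl_iff, Set.mem_prod,
          hτ, false_and, not_false_iff, h0]
    rw [this]
    exact (measurableSet_predictableSigma_Ioc hvt (hC hB.compl)).compl
  · have : (fun q : T × Ω => (Set.Ioc v t).indicator (fun _ => C q.2) q.1) ⁻¹' B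
        = Set.Ioc v t ×ˢ (C ⁻¹' B) := by
      ext ⟨τ, ω⟩
      by_cases hτ : τ ∈ Set.Ioc v t
      · simp only [Set.mem_preimage, Set.indicator_of_mem hτ, Set.mem_prod, hτ, true_and]
      · simp only [Set.mem_preimage, Set.indicator_of_notMem hτ, Set.mem_prod, hτ, false_and, h0]
    rw [this]
    exact measurableSet_predictableSigma_Ioc hvt (hC hB)

lemma Elementary.measurable_eval (S : Elementary ℱ r n h) :
    Measurable[predictableSigma ℱ] (fun q : T × Ω => S.eval q.1 q.2) := by
  unfold Elementary.eval
  exact Finset.measurable_fun_sum _ fun l _ =>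
    measurable_indicator_Ioc (S.t_mono Fin.castSucc_lt_succ) (S.meas l)

lemma Elementary.measurable_eval' (S : Elementary ℱ r n h) :
    Measurable (fun q : T × Ω => S.eval q.1 q.2) :=
  S.measurable_eval.mono (predictableSigma_le ℱ) le_rfl

/-- Mixed intersections are empty: times are nonnegative, so 0 lies in no interval $(v,t]$. -/
lemma isPiSystem_predictable (hT : IsTimeSet T) (ℱ : Filtration T mΩ) : IsPiSystem
    ({s : Set (T × Ω) | ∃ (v t : T) (A : Set Ω),
        v < t ∧ MeasurableSet[ℱ v] A ∧ s = Set.Ioc v t ×ˢ A} ∪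
     {s | ∃ (z : T) (A : Set Ω), (z : ℝ) = 0 ∧ MeasurableSet[ℱ z] A ∧ s = {z} ×ˢ A}) := by
  have hnot : ∀ {v t z : T}, (z : ℝ) = 0 → z ∉ Set.Ioc v t := fun {v t z} hz hmem => by
    have h1 : (v : ℝ) < z := hmem.1
    have h2 := hT.nonneg v
    linarith
  rintro s (⟨v, t, A, hvt, hA, rfl⟩ | ⟨z, A, hz, hA, rfl⟩) s'
    (⟨v', t', A', hvt', hA', rfl⟩ | ⟨z', A', hz', hA', rfl⟩) hne
  · rw [Set.prod_inter_prod, Set.Ioc_inter_Ioc]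
    rw [Set.prod_inter_prod, Set.Ioc_inter_Ioc] at hne
    refine Or.inl ⟨v ⊔ v', t ⊓ t', A ∩ A', ?_, ?_, rfl⟩
    · exact Set.nonempty_Ioc.1 hne.fst
    · exact (ℱ.mono le_sup_left _ hA).inter (ℱ.mono le_sup_right _ hA')
  · obtain ⟨⟨x, ω⟩, ⟨hx, -⟩, ⟨hx', -⟩⟩ := hne
    obtain rfl : x = z' := hx'
    exact absurd hx (hnot hz')
  · obtain ⟨⟨x, ω⟩, ⟨hx, -⟩, ⟨hx', -⟩⟩ := hne
    obtain rfl : x = z := hx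
    exact absurd hx' (hnot hz)
  · obtain rfl : z = z' := Subtype.ext (hz.trans hz'.symm)
    rw [Set.prod_inter_prod, Set.inter_self]
    exact Or.inr ⟨z, A ∩ A', hz, hA.inter hA', rfl⟩

lemma Elementary.exists_indicator (hT : IsTimeSet T) {v t : T} (hvt : v < t) {C : Ω → Lr r n h}
    (hC : Measurable[ℱ v] C) :
    ∃ E : Elementary ℱ r n h, ∀ τ ω, E.eval τ ω = (Set.Ioc v t).indicator (fun _ => C ω) τ := by
  rcases (hT.nonneg v).eq_or_lt with hv | hv
  · refine ⟨⟨1, ![v, t], hv.symm, ?_, fun _ => C, ?_⟩, fun τ ω => ?_⟩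
    · exact Fin.strictMono_iff_lt_succ.2 fun i => by
        rw [Subsingleton.elim i 0]; exact hvt
    · intro l
      rw [Subsingleton.elim l 0]
      exact hC
    · exact Fin.sum_univ_one _
  -- Elementary functions must start at time 0, so an idle interval $(0,v]$ with coefficient 0 is
  -- put in front.
  · refine ⟨⟨2, ![⟨0, hT.zero_mem⟩, v, t], rfl, ?_, ![fun _ => 0, C], ?_⟩, fun τ ω => ?_⟩
    · refine Fin.strictMono_iff_lt_succ.2 (Fin.forall_fin_two.2 ⟨?_, ?_⟩)
      · exact hv
      · exact hvt
    · refine Fin.forall_fin_two.2 ⟨?_, ?_⟩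
      · exact measurable_const
      · exact hC
    · refine (Fin.sum_univ_two _).trans ?_
      change (Set.Ioc _ v).indicator (fun _ => (0 : Lr r n h)) τ
        + (Set.Ioc v t).indicator (fun _ => C ω) τ = _
      rw [congrFun (Set.indicator_zero (Lr r n h) _) τ, zero_add]

/-- The measure `λ|_[β, γ] × P`. -/
def timeMeasure (P : Measure Ω) (β γ : T) : Measure (T × Ω) :=
  ((lebesgue T).restrict (Set.Icc β γ)).prod P

lemma IsTimeSet.isFiniteMeasure_timeMeasure (hT : IsTimeSet T) [IsProbabilityMeasure P] (β γ : T) :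
    IsFiniteMeasure (timeMeasure P β γ) := by
  have := hT.isFiniteMeasure β γ
  unfold timeMeasure
  infer_instance

lemma IsTimeSet.timeMeasure_singleton_prod (hT : IsTimeSet T) [IsProbabilityMeasure P] (β γ z : T)
    (A : Set Ω) : timeMeasure P β γ ({z} ×ˢ A) = 0 := by
  have := hT.isFiniteMeasure β γ
  rw [timeMeasure, Measure.prod_prod]
  have : (lebesgue T).restrict (Set.Icc β γ) {z} = 0 :=
    le_antisymm ((Measure.restrict_apply_le _ _).trans (hT.lebesgue_singleton z).le) bot_le
  rw [this, zero_mul]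

/-- Elementary functions vanish at time 0, so constants are elementary only off the null slice
$\{0\}\times\Omega$. -/
lemma IsTimeSet.timeMeasure_compl_Ioc (hT : IsTimeSet T) [IsProbabilityMeasure P] {β γ z : T}
    (hz : (z : ℝ) = 0) : timeMeasure P β γ (Set.Ioc z γ ×ˢ Set.univ)ᶜ = 0 := by
  have := hT.isFiniteMeasure β γ
  have hset : (Set.Ioc z γ ×ˢ (Set.univ : Set Ω))ᶜ = (Set.Ioc z γ)ᶜ ×ˢ Set.univ := by
    ext ⟨τ, ω⟩; simp
  rw [hset, timeMeasure, Measure.prod_prod,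
    Measure.restrict_apply measurableSet_Ioc.compl]
  have hsub : (Set.Ioc z γ)ᶜ ∩ Set.Icc β γ ⊆ {z} := by
    rintro τ ⟨h1, h2⟩
    have h3 : ¬ z < τ := fun h => h1 ⟨h, h2.2⟩
    have h4 : z ≤ τ := by
      change (z : ℝ) ≤ τ
      rw [hz]; exact hT.nonneg τ
    exact (h4.antisymm (not_lt.1 h3)).symm
  rw [measure_mono_null hsub (hT.lebesgue_singleton z), zero_mul]

/-- The density theorem is applied to the measure trimmed to $\mathcal G$, since approximation must
proceed from the generators of $\mathcal G$ and not of the product σ-algebra. -/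
lemma IsTimeSet.exists_elementary_approx (hT : IsTimeSet T) [IsProbabilityMeasure P]
    (ℱ : Filtration T mΩ) (V : Fin 2 → Lr r n n) {a b : T} (hab : a < b) {G : T × Ω → Lr r n h}
    (hG : Measurable[predictableSigma ℱ] G)
    (hfin : ∫⁻ q, ENNReal.ofReal (‖coeffMap V (G q)‖ ^ 2) ∂(timeMeasure P a b) < ∞)
    {ε : ℝ≥0∞} (hε : ε ≠ 0) :
    ∃ E : Elementary ℱ r n h,
      eLpNorm (fun q => coeffMap V (G q - E.eval q.1 q.2)) 2 (timeMeasure P a b) ≤ ε := by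
  have hle := predictableSigma_le ℱ
  have hfm := hT.isFiniteMeasure_timeMeasure (P := P) a b
  have hfm' : IsFiniteMeasure ((timeMeasure P a b).trim hle) := isFiniteMeasure_trim hle
  set z : T := ⟨0, hT.zero_mem⟩ with hz
  have hzb : z < b := lt_of_le_of_lt (hT.nonneg a : (z : ℝ) ≤ a) hab
  set Q : (T × Ω → Lr r n h) → Prop := fun g =>
    ∃ E : Elementary ℱ r n h, g = fun q => E.eval q.1 q.2 with hQ
  have hadd : ∀ f g, Q f → Q g → Q (f + g) := by
    rintro _ _ ⟨E, rfl⟩ ⟨E', rfl⟩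
    obtain ⟨D, hD, -⟩ := E.exists_add_smul E' 1
    exact ⟨D, funext fun q => by simp [hD]⟩
  have hsub : ∀ f g, Q f → Q g → Q (f - g) := by
    rintro _ _ ⟨E, rfl⟩ ⟨E', rfl⟩
    obtain ⟨D, hD, -⟩ := E.exists_sub E'
    exact ⟨D, funext fun q => (hD q.1 q.2).symm⟩
  have hmeas : ∀ f, Q f → Measurable[predictableSigma ℱ] f := by
    rintro _ ⟨E, rfl⟩
    exact E.measurable_eval
  have hnull : ∀ {s : Set (T × Ω)}, MeasurableSet[predictableSigma ℱ] s →
      timeMeasure P a b s = 0 → (timeMeasure P a b).trim hle s = 0 := fun hs h0 => by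
    rw [trim_measurableSet_eq hle hs, h0]
  have huniv : ∀ c : Lr r n h, ∃ g, Q g ∧ g =ᵐ[(timeMeasure P a b).trim hle] fun _ => c := by
    intro c
    obtain ⟨E, hE⟩ := Elementary.exists_indicator (ℱ := ℱ) hT hzb
      (measurable_const (a := c))
    refine ⟨_, ⟨E, rfl⟩, ?_⟩
    refine measure_mono_null ?_ (hnull
      (measurableSet_predictableSigma_Ioc hzb MeasurableSet.univ).compl
      (hT.timeMeasure_compl_Ioc (P := P) (β := a) (γ := b) (z := z) rfl))
    rintro ⟨τ, ω⟩ hne hmem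
    refine hne ?_
    change E.eval τ ω = c
    rw [hE, Set.indicator_of_mem hmem.1]
  have hC : ∀ s ∈ ({s : Set (T × Ω) | ∃ (v t : T) (A : Set Ω),
        v < t ∧ MeasurableSet[ℱ v] A ∧ s = Set.Ioc v t ×ˢ A} ∪
     {s | ∃ (z : T) (A : Set Ω), (z : ℝ) = 0 ∧ MeasurableSet[ℱ z] A ∧ s = {z} ×ˢ A}),
      ∀ c : Lr r n h, ∃ g, Q g ∧ g =ᵐ[(timeMeasure P a b).trim hle] s.indicator fun _ => c := by
    rintro s (⟨v, t, A, hvt, hA, rfl⟩ | ⟨z', A, hz', hA, rfl⟩) c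
    · obtain ⟨E, hE⟩ := Elementary.exists_indicator (ℱ := ℱ) hT hvt
        ((measurable_const (a := c)).indicator hA)
      refine ⟨_, ⟨E, rfl⟩, .of_forall ?_⟩
      rintro ⟨τ, ω⟩
      change E.eval τ ω = _
      rw [hE]
      by_cases h1 : τ ∈ Set.Ioc v t
      · by_cases h2 : ω ∈ A
        · rw [Set.indicator_of_mem h1, Set.indicator_of_mem h2,
            Set.indicator_of_mem (Set.mk_mem_prod h1 h2)]
        · rw [Set.indicator_of_mem h1, Set.indicator_of_notMem h2,
            Set.indicator_of_notMem fun h => h2 h.2]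
      · rw [Set.indicator_of_notMem h1, Set.indicator_of_notMem fun h => h1 h.1]
    · obtain ⟨E, hE⟩ := Elementary.exists_indicator (ℱ := ℱ) hT hzb
        (measurable_const (a := (0 : Lr r n h)))
      refine ⟨_, ⟨E, rfl⟩, ?_⟩
      have hs : MeasurableSet[predictableSigma ℱ] ({z'} ×ˢ A) :=
        MeasurableSpace.measurableSet_generateFrom (Or.inr ⟨z', A, hz', hA, rfl⟩)
      refine measure_mono_null ?_ (hnull hs (hT.timeMeasure_singleton_prod a b z' A))
      intro q hne
      by_contra hmem
      refine hne ?_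
      change E.eval q.1 q.2 = _
      rw [hE, Set.indicator_of_notMem hmem]
      exact congrFun (Set.indicator_zero (Lr r n h) _) _
  have hfin' : ∫⁻ q, ENNReal.ofReal (‖coeffMap V (G q)‖ ^ 2) ∂((timeMeasure P a b).trim hle)
      < ∞ := by
    have hm : Measurable fun A : Lr r n h => ENNReal.ofReal (‖coeffMap V A‖ ^ 2) :=
      ((measurable_coeffMap V).norm.pow_const 2).ennreal_ofReal
    have hGm : Measurable[predictableSigma ℱ]
        fun q => ENNReal.ofReal (‖coeffMap V (G q)‖ ^ 2) := hm.comp hG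
    rw [lintegral_trim hle hGm]
    exact hfin
  obtain ⟨_, ⟨E, rfl⟩, hE⟩ := exists_approx_of_submodule (m := predictableSigma ℱ)
    (μ := (timeMeasure P a b).trim hle) (Lr r n h) rfl (isPiSystem_predictable hT ℱ)
    hadd hsub hmeas huniv hC (coeffMap V) hG hfin' hε
  refine ⟨E, ?_⟩
  have hm : Measurable[predictableSigma ℱ] fun q => coeffMap V (G q - E.eval q.1 q.2) :=
    (measurable_coeffMap V).comp (hG.sub E.measurable_eval)
  rwa [eLpNorm_trim hle hm.stronglyMeasurable] at hE

/-- Every set in the completion is null-measurable for the trimmed measure. A null-measurable map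
into a countably generated space has a measurable version. -/
lemma exists_measurable_of_isPredictable {X : Type*} [MeasurableSpace X]
    [MeasurableSpace.CountablyGenerated X] [Nonempty X] {S : T → Ω → X}
    (hS : IsPredictable P ℱ S) :
    ∃ G : T × Ω → X, Measurable[predictableSigma ℱ] G ∧
      (fun q : T × Ω => S q.1 q.2) =ᵐ[(lebesgue T).prod P] G := by
  have hle := predictableSigma_le ℱ
  set μ := ((lebesgue T).prod P).trim hle with hμ
  have hcomp : predictableCompletion P ℱ
      ≤ @eventuallyMeasurableSpace _ (predictableSigma ℱ) (ae μ) _ := by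
    refine MeasurableSpace.generateFrom_le ?_
    rintro s (hs | ⟨N, hN, h0, hsN⟩)
    · exact ⟨s, hs, EventuallyEq.refl _ _⟩
    · refine ⟨∅, @MeasurableSet.empty _ (predictableSigma ℱ), ?_⟩
      refine ae_eq_empty.2 (measure_mono_null hsN ?_)
      rw [hμ, trim_measurableSet_eq hle hN, h0]
  have hnull : @NullMeasurable _ _ (predictableSigma ℱ) _ (fun q : T × Ω => S q.1 q.2) μ :=
    fun s hs => hcomp _ (hS hs)
  obtain ⟨G, hG, hSG⟩ := @NullMeasurable.aemeasurable _ _ (predictableSigma ℱ) _ μ _ _ hnull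
  exact ⟨G, hG, ae_eq_of_ae_eq_trim hSG⟩

end Predictable

/-! ### The stochastic integral -/

section Integral

lemma tendsto_zero_of_const_mul_sq {u : ℕ → ℝ≥0∞} {c : ℝ≥0∞} (hc : c ≠ 0) (hc' : c ≠ ∞) :
    Tendsto (fun k => c * u k ^ 2) atTop (𝓝 0) ↔ Tendsto u atTop (𝓝 0) := by
  constructor
  · intro h
    have h1 := ENNReal.Tendsto.const_mul (a := c⁻¹) h (Or.inr (ENNReal.inv_ne_top.2 hc))
    rw [mul_zero] at h1
    have h2 := ((ENNReal.continuous_rpow_const (y := (1 / 2 : ℝ))).tendsto 0).comp h1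
    rw [ENNReal.zero_rpow_of_pos (by norm_num)] at h2
    refine h2.congr fun k => ?_
    simp only [Function.comp]
    rw [← mul_assoc, ENNReal.inv_mul_cancel hc hc', one_mul, ← ENNReal.rpow_natCast,
      ← ENNReal.rpow_mul]
    norm_num
  · intro h
    have h1 := ENNReal.Tendsto.const_mul (a := c) (ENNReal.Tendsto.pow (n := 2) h) (Or.inr hc')
    simpa using h1

variable {r n h : ℕ} {Ω : Type*} [mΩ : MeasurableSpace Ω] {T : Set ℝ} {P : Measure Ω}
  {ℱ : Filtration T mΩ} {V : Fin 2 → Lr r n n} {w₀ w₁ : T → Ω → Fin n → CD r}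

lemma measurable_toLp_iff {Z : Ω → Fin h → CDC r} :
    Measurable (fun ω => (WithLp.toLp 2 (Z ω) : HSpace r h)) ↔ Measurable Z :=
  ⟨fun hZ => (WithLp.measurable_ofLp 2 _).comp hZ, fun hZ => (WithLp.measurable_toLp 2 _).comp hZ⟩

/-- The mean square norm of an `𝒜_{r,C}^h`-valued random variable, up to the factor `√2`. -/
def meanNorm (P : Measure Ω) (Z : Ω → Fin h → CDC r) : ℝ≥0∞ :=
  eLpNorm (fun ω => (WithLp.toLp 2 (Z ω) : HSpace r h)) 2 P

lemma lintegral_normSq (P : Measure Ω) (Z : Ω → Fin h → CDC r) :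
    ∫⁻ ω, ENNReal.ofReal (normSq (Z ω)) ∂P = 2 * meanNorm P Z ^ 2 := by
  rw [meanNorm, ← lintegral_ofReal_norm_sq, ← lintegral_const_mul' _ _ (by simp)]
  refine lintegral_congr fun ω => ?_
  rw [normSq_eq, ENNReal.ofReal_mul (by norm_num)]
  simp

lemma meanNorm_add_le {Y Z : Ω → Fin h → CDC r} (hY : Measurable Y) (hZ : Measurable Z) :
    meanNorm P (fun ω => Y ω + Z ω) ≤ meanNorm P Y + meanNorm P Z :=
  eLpNorm_add_le (measurable_toLp_iff.2 hY).aestronglyMeasurable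
    (measurable_toLp_iff.2 hZ).aestronglyMeasurable (by norm_num)

lemma meanNorm_sub_comm (Y Z : Ω → Fin h → CDC r) :
    meanNorm P (fun ω => Y ω - Z ω) = meanNorm P (fun ω => Z ω - Y ω) :=
  eLpNorm_sub_comm (fun ω => (WithLp.toLp 2 (Y ω) : HSpace r h)) (fun ω => WithLp.toLp 2 (Z ω)) 2 P

lemma meanNorm_sub_le {X Y Z : Ω → Fin h → CDC r} (hX : Measurable X) (hY : Measurable Y)
    (hZ : Measurable Z) :
    meanNorm P (fun ω => X ω - Z ω)
      ≤ meanNorm P (fun ω => X ω - Y ω) + meanNorm P (fun ω => Y ω - Z ω) := by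
  refine le_of_eq_of_le ?_ (meanNorm_add_le (hX.sub hY) (hY.sub hZ))
  simp only [sub_add_sub_cancel]

lemma ae_eq_of_meanNorm_eq_zero {Y Z : Ω → Fin h → CDC r} (hY : Measurable Y) (hZ : Measurable Z)
    (h0 : meanNorm P (fun ω => Y ω - Z ω) = 0) : Y =ᵐ[P] Z := by
  have hm : Measurable fun ω => (WithLp.toLp 2 (Y ω - Z ω) : HSpace r h) :=
    measurable_toLp_iff.2 (hY.sub hZ)
  rw [meanNorm, eLpNorm_eq_zero_iff hm.aestronglyMeasurable (by norm_num)] at h0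
  filter_upwards [h0] with ω hω
  exact sub_eq_zero.1 ((WithLp.toLp_eq_zero 2).1 hω)

lemma map_sub_of_submodule {E G : Type*} [AddCommGroup E] [Module ℝ E] [AddCommGroup G]
    [Module ℝ G] (W : Submodule ℝ E) (f : W →ₗ[ℝ] G) (x y : W) : f (x - y) = f x - f y :=
  map_sub f x y

lemma coeffMap_sub (V : Fin 2 → Lr r n n) (A B : Lr r n h) :
    coeffMap V (A - B) = coeffMap V A - coeffMap V B :=
  map_sub_of_submodule _ _ A B

/-- The square root of the energy. -/
def energyNorm (P : Measure Ω) (V : Fin 2 → Lr r n n) (β γ : T) (S : T → Ω → Lr r n h) : ℝ≥0∞ :=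
  eLpNorm (fun q : T × Ω => coeffMap V (S q.1 q.2)) 2 (timeMeasure P β γ)

/-- Measurability of a random function up to null sets of the restricted product measure. -/
def IsAEMeas (P : Measure Ω) (β γ : T) (S : T → Ω → Lr r n h) : Prop :=
  AEMeasurable (fun q : T × Ω => S q.1 q.2) (timeMeasure P β γ)

lemma IsAEMeas.aestronglyMeasurable {β γ : T} {S : T → Ω → Lr r n h} (hS : IsAEMeas P β γ S)
    (V : Fin 2 → Lr r n n) :
    AEStronglyMeasurable (fun q : T × Ω => coeffMap V (S q.1 q.2)) (timeMeasure P β γ) :=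
  ((measurable_coeffMap V).comp_aemeasurable hS).aestronglyMeasurable

lemma Elementary.isAEMeas (S : Elementary ℱ r n h) (β γ : T) : IsAEMeas P β γ S.eval :=
  S.measurable_eval'.aemeasurable

lemma energyNorm_sub_le {β γ : T} {X Y Z : T → Ω → Lr r n h} (hX : IsAEMeas P β γ X)
    (hY : IsAEMeas P β γ Y) (hZ : IsAEMeas P β γ Z) :
    energyNorm P V β γ (fun τ ω => X τ ω - Z τ ω)
      ≤ energyNorm P V β γ (fun τ ω => Y τ ω - X τ ω)
        + energyNorm P V β γ (fun τ ω => Y τ ω - Z τ ω) := by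
  have h1 := eLpNorm_sub_le (p := 2) ((hY.aestronglyMeasurable V).sub (hZ.aestronglyMeasurable V))
    ((hY.aestronglyMeasurable V).sub (hX.aestronglyMeasurable V)) (by norm_num)
  rw [add_comm] at h1
  unfold energyNorm
  simp_rw [coeffMap_sub]
  refine le_of_eq_of_le (congrArg (fun f => eLpNorm f 2 (timeMeasure P β γ)) ?_) h1
  funext q
  simp only [Pi.sub_apply, sub_sub_sub_cancel_left]

lemma energyNorm_le_add {β γ : T} {X Y : T → Ω → Lr r n h} (hX : IsAEMeas P β γ X)
    (hY : IsAEMeas P β γ Y) :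
    energyNorm P V β γ X
      ≤ energyNorm P V β γ Y + energyNorm P V β γ (fun τ ω => Y τ ω - X τ ω) := by
  have h1 := eLpNorm_sub_le (p := 2) (hY.aestronglyMeasurable V)
    ((hY.aestronglyMeasurable V).sub (hX.aestronglyMeasurable V)) (by norm_num)
  unfold energyNorm
  simp_rw [coeffMap_sub]
  refine le_of_eq_of_le (congrArg (fun f => eLpNorm f 2 (timeMeasure P β γ)) ?_) h1
  funext q
  simp only [Pi.sub_apply, sub_sub_cancel]

lemma energy_mono {a b β γ : T} (ha : a ≤ β) (hb : γ ≤ b) (S : T → Ω → Lr r n h) :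
    energy P V β γ S ≤ energy P V a b S :=
  lintegral_mono fun _ => lintegral_mono_set (Set.Icc_subset_Icc ha hb)

lemma Approximates.mono {a b β γ : T} (ha : a ≤ β) (hb : γ ≤ b) {S : T → Ω → Lr r n h}
    {Sκ : ℕ → Elementary ℱ r n h} (hS : Approximates P V a b S Sκ) :
    Approximates P V β γ S Sκ :=
  tendsto_of_tendsto_of_tendsto_of_le_of_le tendsto_const_nhds hS (fun _ => bot_le)
    fun _ => energy_mono ha hb _

variable [IsProbabilityMeasure P]

/-- Tonelli: the iterated integral becomes one over the product, where $F$ is a squared norm, so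
Minkowski's inequality becomes available. -/
lemma IsTimeSet.energy_eq (hT : IsTimeSet T) {β γ : T} {S : T → Ω → Lr r n h}
    (hS : IsAEMeas P β γ S) : energy P V β γ S = energyNorm P V β γ S ^ 2 := by
  have := hT.isFiniteMeasure β γ
  have hm : AEMeasurable (fun q : T × Ω => ENNReal.ofReal (F V (S q.1 q.2)))
      (((lebesgue T).restrict (Set.Icc β γ)).prod P) := (measurable_F V).comp_aemeasurable hS
  rw [energyNorm, ← lintegral_ofReal_norm_sq]
  simp_rw [← F_eq_norm_sq]
  exact (lintegral_prod_symm _ hm).symm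

lemma IsTimeSet.isAEMeas_of_isPredictable (hT : IsTimeSet T) {S : T → Ω → Lr r n h}
    (hS : IsPredictable P ℱ S) (β γ : T) :
    ∃ G : T × Ω → Lr r n h, Measurable[predictableSigma ℱ] G ∧
      (fun q : T × Ω => S q.1 q.2) =ᵐ[timeMeasure P β γ] G := by
  have := hT.sigmaFinite
  obtain ⟨G, hG, hSG⟩ := exists_measurable_of_isPredictable hS
  exact ⟨G, hG, (Measure.AbsolutelyContinuous.prod
    Measure.restrict_le_self.absolutelyContinuous .rfl).ae_eq hSG⟩

lemma IsTimeSet.approximates_iff (hT : IsTimeSet T) {S : T → Ω → Lr r n h} {β γ : T}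
    (hS : IsAEMeas P β γ S) (Sκ : ℕ → Elementary ℱ r n h) :
    Approximates P V β γ S Sκ ↔
      Tendsto (fun κ => energyNorm P V β γ fun τ ω => S τ ω - (Sκ κ).eval τ ω) atTop (𝓝 0) := by
  rw [← tendsto_zero_of_const_mul_sq one_ne_zero ENNReal.one_ne_top, Approximates]
  have : ∀ κ, IsAEMeas P β γ fun τ ω => S τ ω - (Sκ κ).eval τ ω := fun κ =>
    AEMeasurable.sub hS ((Sκ κ).isAEMeas β γ)
  simp_rw [hT.energy_eq (this _), one_mul]

omit [IsProbabilityMeasure P] in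
lemma IsNoise.measurable_integral (hw : IsNoise P ℱ V w₀ w₁) (S : Elementary ℱ r n h) (β γ : T) :
    Measurable (S.integral (combine w₀ w₁) β γ) := by
  unfold Elementary.integral
  refine Finset.measurable_fun_sum _ fun l _ => ?_
  exact (WithLp.measurable_ofLp 2 _).comp (measurable_apply_pair.comp
    (((S.meas l).mono (ℱ.le _) le_rfl).prodMk ((hw.measurable _).sub (hw.measurable _))))

/-- The factor 2 cancels between the two sides, leaving a contraction with constant 1. -/
lemma IsNoise.meanNorm_integral_le (hw : IsNoise P ℱ V w₀ w₁) (hT : IsTimeSet T)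
    (S : Elementary ℱ r n h) {β γ : T} (hβγ : β ≤ γ) :
    meanNorm P (S.integral (combine w₀ w₁) β γ) ≤ energyNorm P V β γ S.eval := by
  have h1 := hw.lintegral_normSq_integral_le hT S hβγ
  rw [lintegral_normSq, hT.energy_eq (S.isAEMeas β γ),
    ENNReal.mul_le_mul_iff_right (by norm_num) (by norm_num)] at h1
  exact (ENNReal.pow_le_pow_left_iff two_ne_zero).1 h1

lemma IsNoise.meanNorm_integral_sub_le (hw : IsNoise P ℱ V w₀ w₁) (hT : IsTimeSet T)
    (S S' : Elementary ℱ r n h) {β γ : T} (hβγ : β ≤ γ) :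
    meanNorm P (fun ω => S.integral (combine w₀ w₁) β γ ω - S'.integral (combine w₀ w₁) β γ ω)
      ≤ energyNorm P V β γ (fun τ ω => S.eval τ ω - S'.eval τ ω) := by
  obtain ⟨D, hD, hDI⟩ := S.exists_sub S'
  have h1 := hw.meanNorm_integral_le hT D hβγ
  rwa [show D.integral (combine w₀ w₁) β γ = _ from funext (hDI (combine w₀ w₁) β γ),
    show D.eval = _ from funext fun τ => funext (hD τ)] at h1

/-- Predictable random functions of finite energy are limits of elementary ones, at any rate. -/
lemma IsTimeSet.exists_seq (hT : IsTimeSet T) {a b : T} (hab : a < b) {S : T → Ω → Lr r n h}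
    (hS : S ∈ V21 P ℱ V a b h) {ε : ℕ → ℝ≥0∞} (hε : ∀ κ, ε κ ≠ 0) :
    ∃ Sκ : ℕ → Elementary ℱ r n h,
      ∀ κ, energyNorm P V a b (fun τ ω => S τ ω - (Sκ κ).eval τ ω) ≤ ε κ := by
  obtain ⟨G, hG, hSG⟩ := hT.isAEMeas_of_isPredictable hS.1 a b
  have hSm : IsAEMeas P a b S := ⟨G, hG.mono (predictableSigma_le ℱ) le_rfl, hSG⟩
  have hfin := hS.2
  rw [hT.energy_eq hSm, energyNorm, ← lintegral_ofReal_norm_sq] at hfin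
  have hcongr : (fun q : T × Ω => ENNReal.ofReal (‖coeffMap V (S q.1 q.2)‖ ^ 2))
      =ᵐ[timeMeasure P a b] fun q => ENNReal.ofReal (‖coeffMap V (G q)‖ ^ 2) := by
    filter_upwards [hSG] with q hq
    rw [hq]
  rw [lintegral_congr_ae hcongr] at hfin
  choose E hE using fun κ => hT.exists_elementary_approx ℱ V hab hG hfin (hε κ)
  refine ⟨E, fun κ => le_of_eq_of_le (eLpNorm_congr_ae ?_) (hE κ)⟩
  filter_upwards [hSG] with q hq
  rw [hq]

end Integral

/-! ### Existence, uniqueness and additivity of the integral -/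

section Existence

variable {r n h : ℕ} {Ω : Type*} [mΩ : MeasurableSpace Ω] {T : Set ℝ} {P : Measure Ω}
  {ℱ : Filtration T mΩ} {V : Fin 2 → Lr r n n} {w₀ w₁ : T → Ω → Fin n → CD r}
  [IsProbabilityMeasure P]

lemma IsTimeSet.isAEMeas (hT : IsTimeSet T) {S : T → Ω → Lr r n h}
    (hS : IsPredictable P ℱ S) (β γ : T) : IsAEMeas P β γ S := by
  obtain ⟨G, hG, hSG⟩ := hT.isAEMeas_of_isPredictable hS β γ
  exact ⟨G, hG.mono (predictableSigma_le ℱ) le_rfl, hSG⟩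

omit [IsProbabilityMeasure P] in
lemma IsAEMeas.sub {β γ : T} {X Y : T → Ω → Lr r n h} (hX : IsAEMeas P β γ X)
    (hY : IsAEMeas P β γ Y) : IsAEMeas P β γ fun τ ω => X τ ω - Y τ ω :=
  AEMeasurable.sub hX hY

lemma IsTimeSet.energyNorm_mono (hT : IsTimeSet T) {a b β γ : T} (ha : a ≤ β) (hb : γ ≤ b)
    {S : T → Ω → Lr r n h} (h1 : IsAEMeas P β γ S) (h2 : IsAEMeas P a b S) :
    energyNorm P V β γ S ≤ energyNorm P V a b S := by
  rw [← ENNReal.pow_le_pow_left_iff two_ne_zero, ← hT.energy_eq h1, ← hT.energy_eq h2]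
  exact energy_mono ha hb S

omit [IsProbabilityMeasure P] in
lemma tendsto_lintegral_normSq_iff {Z : ℕ → Ω → Fin h → CDC r} :
    Tendsto (fun κ => ∫⁻ ω, ENNReal.ofReal (normSq (Z κ ω)) ∂P) atTop (𝓝 0)
      ↔ Tendsto (fun κ => meanNorm P (Z κ)) atTop (𝓝 0) := by
  simp_rw [lintegral_normSq]
  exact tendsto_zero_of_const_mul_sq (by norm_num) (by norm_num)

/-- A rapidly approximating sequence of elementary functions has convergent integrals. -/
lemma IsNoise.exists_limit (hw : IsNoise P ℱ V w₀ w₁) (hT : IsTimeSet T) {β γ : T} (hβγ : β ≤ γ)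
    {S : T → Ω → Lr r n h} (hS : IsAEMeas P β γ S) (hfin : energyNorm P V β γ S < ∞)
    {E : ℕ → Elementary ℱ r n h}
    (hE : ∀ κ, energyNorm P V β γ (fun τ ω => S τ ω - (E κ).eval τ ω) ≤ 2⁻¹ ^ (κ + 2)) :
    ∃ Y : Ω → Fin h → CDC r, Measurable Y ∧
      Tendsto (fun κ => meanNorm P fun ω => (E κ).integral (combine w₀ w₁) β γ ω - Y ω)
        atTop (𝓝 0) := by
  set f : ℕ → Ω → HSpace r h := fun κ ω =>
    WithLp.toLp 2 ((E κ).integral (combine w₀ w₁) β γ ω) with hf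
  have hfm : ∀ κ, AEStronglyMeasurable (f κ) P := fun κ =>
    (measurable_toLp_iff.2 (hw.measurable_integral (E κ) β γ)).aestronglyMeasurable
  have hpow : ∀ κ, (2⁻¹ : ℝ≥0∞) ^ κ < ∞ := fun κ => ENNReal.pow_lt_top (by simp)
  have hmem : ∀ κ, MemLp (f κ) 2 P := fun κ => by
    refine ⟨hfm κ, ((hw.meanNorm_integral_le hT (E κ) hβγ).trans
      (energyNorm_le_add ((E κ).isAEMeas β γ) hS)).trans_lt ?_⟩
    exact ENNReal.add_lt_top.2 ⟨hfin, (hE κ).trans_lt (hpow _)⟩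
  have hB : ∑' κ : ℕ, (2⁻¹ : ℝ≥0∞) ^ κ ≠ ∞ := by
    rw [ENNReal.tsum_geometric]
    simp [ENNReal.one_sub_inv_two]
  -- The exponent $\kappa+2$ leaves room: two errors of size $2^{-(N+2)}$ add up to $2^{-(N+1)}$,
  -- strictly below the summable bound $2^{-N}$ demanded by the completeness criterion.
  have hcau : ∀ N k l : ℕ, N ≤ k → N ≤ l → eLpNorm (f k - f l) 2 P < 2⁻¹ ^ N := by
    intro N k l hk hl
    have hle : ∀ j, N ≤ j → (2⁻¹ : ℝ≥0∞) ^ (j + 2) ≤ 2⁻¹ ^ (N + 2) := fun j hj =>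
      pow_le_pow_right_of_le_one' (by simp) (by omega)
    have h1 : eLpNorm (f k - f l) 2 P ≤ 2⁻¹ ^ (N + 2) + 2⁻¹ ^ (N + 2) :=
      (hw.meanNorm_integral_sub_le hT (E k) (E l) hβγ).trans
        ((energyNorm_sub_le ((E k).isAEMeas β γ) hS ((E l).isAEMeas β γ)).trans
          (add_le_add ((hE k).trans (hle k hk)) ((hE l).trans (hle l hl))))
    refine h1.trans_lt ?_
    have h2 : (2⁻¹ : ℝ≥0∞) ^ (N + 2) + 2⁻¹ ^ (N + 2) = 2⁻¹ ^ N * 2⁻¹ := by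
      rw [← two_mul, pow_add, pow_two, mul_left_comm, ← mul_assoc (2 : ℝ≥0∞),
        ENNReal.mul_inv_cancel (by norm_num) (by norm_num), one_mul]
    rw [h2]
    calc (2⁻¹ : ℝ≥0∞) ^ N * 2⁻¹ < 2⁻¹ ^ N * 1 :=
          ENNReal.mul_lt_mul_right (pow_ne_zero _ (by simp)) (hpow N).ne (by simp)
      _ = 2⁻¹ ^ N := mul_one _
  obtain ⟨g, hg, hlim⟩ := Lp.cauchy_complete_eLpNorm (by norm_num) hmem hB hcau
  -- The limit is replaced by its measurable representative, because a stochastic integral must be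
  -- measurable everywhere and not merely up to null sets.
  refine ⟨fun ω => WithLp.ofLp (hg.1.mk g ω),
    (WithLp.measurable_ofLp 2 _).comp hg.1.stronglyMeasurable_mk.measurable, ?_⟩
  refine hlim.congr fun κ => eLpNorm_congr_ae ?_
  filter_upwards [hg.1.ae_eq_mk] with ω hω
  rw [Pi.sub_apply, hω]
  rfl

/-- Any other approximating sequence is close in energy to the fast one, so by the contraction its
integrals share the same limit. -/
lemma IsNoise.exists_isStochasticIntegral (hw : IsNoise P ℱ V w₀ w₁) (hT : IsTimeSet T)
    {a b β γ : T} (hab : a < b) (ha : a ≤ β) (hβγ : β ≤ γ) (hb : γ ≤ b) {S : T → Ω → Lr r n h}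
    (hS : S ∈ V21 P ℱ V a b h) :
    ∃ Y : Ω → Fin h → CDC r, IsStochasticIntegral P ℱ V (combine w₀ w₁) S β γ Y := by
  have hm := hT.isAEMeas hS.1 β γ
  have hm' := hT.isAEMeas hS.1 a b
  have hfin : energyNorm P V β γ S < ∞ := by
    have h1 := hS.2
    rw [hT.energy_eq hm'] at h1
    refine (hT.energyNorm_mono ha hb hm hm').trans_lt ?_
    by_contra h2
    rw [not_lt_top_iff.1 h2] at h1
    simp at h1
  obtain ⟨E, hE⟩ := hT.exists_seq hab hS (ε := fun κ => 2⁻¹ ^ (κ + 2))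
    fun κ => pow_ne_zero _ (by simp)
  have hE' : ∀ κ, energyNorm P V β γ (fun τ ω => S τ ω - (E κ).eval τ ω) ≤ 2⁻¹ ^ (κ + 2) :=
    fun κ => (hT.energyNorm_mono ha hb (hm.sub ((E κ).isAEMeas β γ))
      (hm'.sub ((E κ).isAEMeas a b))).trans (hE κ)
  have hpow : Tendsto (fun κ : ℕ => (2⁻¹ : ℝ≥0∞) ^ (κ + 2)) atTop (𝓝 0) :=
    (ENNReal.tendsto_pow_atTop_nhds_zero_of_lt_one (by simp)).comp (tendsto_add_atTop_nat 2)
  have hEt : Tendsto (fun κ => energyNorm P V β γ fun τ ω => S τ ω - (E κ).eval τ ω) atTop (𝓝 0) :=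
    tendsto_of_tendsto_of_tendsto_of_le_of_le tendsto_const_nhds hpow (fun _ => bot_le) hE'
  obtain ⟨Y, hY, hlim⟩ := hw.exists_limit hT hβγ hm hfin hE'
  refine ⟨Y, hY, ⟨E, (hT.approximates_iff hm E).2 hEt⟩, fun Sκ hSκ => ?_⟩
  rw [hT.approximates_iff hm] at hSκ
  rw [tendsto_lintegral_normSq_iff]
  have hsum := (hSκ.add hEt).add hlim
  simp only [add_zero] at hsum
  refine tendsto_of_tendsto_of_tendsto_of_le_of_le tendsto_const_nhds hsum (fun _ => bot_le)
    fun κ => ?_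
  refine (meanNorm_sub_le (hw.measurable_integral _ β γ) (hw.measurable_integral (E κ) β γ)
    hY).trans (add_le_add_left ?_ _)
  exact (hw.meanNorm_integral_sub_le hT _ _ hβγ).trans
    (energyNorm_sub_le ((Sκ κ).isAEMeas β γ) hm ((E κ).isAEMeas β γ))

omit [IsProbabilityMeasure P] in
lemma IsNoise.isStochasticIntegral_unique (hw : IsNoise P ℱ V w₀ w₁) {β γ : T}
    {S : T → Ω → Lr r n h} {Y Y' : Ω → Fin h → CDC r}
    (hY : IsStochasticIntegral P ℱ V (combine w₀ w₁) S β γ Y)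
    (hY' : IsStochasticIntegral P ℱ V (combine w₀ w₁) S β γ Y') : Y' =ᵐ[P] Y := by
  obtain ⟨E, hE⟩ := hY.exists_approx
  have h1 := tendsto_lintegral_normSq_iff.1 (hY.tendsto E hE)
  have h2 := tendsto_lintegral_normSq_iff.1 (hY'.tendsto E hE)
  refine ae_eq_of_meanNorm_eq_zero hY'.measurable hY.measurable ?_
  have hsum := h2.add h1
  simp only [add_zero] at hsum
  refine le_antisymm (ge_of_tendsto' hsum fun κ => ?_) bot_le
  refine (meanNorm_sub_le (P := P) hY'.measurable (hw.measurable_integral (E κ) β γ)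
    hY.measurable).trans ?_
  rw [meanNorm_sub_comm Y' ((E κ).integral (combine w₀ w₁) β γ)]

lemma Elementary.integral_add_integral (S : Elementary ℱ r n h) (w : T → Ω → Fin n → CDC r)
    {a b c : T} (hac : a ≤ c) (hcb : c ≤ b) (ω : Ω) :
    S.integral w a b ω = S.integral w a c ω + S.integral w c b ω := by
  -- Additivity holds pathwise: truncating $t$ to $[a,b]$ differs from truncating to the two halves
  -- only by the constant $w(c)$, which cancels in increments.
  have key : ∀ t : T, w (max a (min t b)) ω
      = w (max a (min t c)) ω + w (max c (min t b)) ω - w c ω := by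
    intro t
    rcases le_total t c with h | h
    · rw [min_eq_left (h.trans hcb), min_eq_left h, max_eq_left h]
      abel
    · rw [min_eq_right h, max_eq_right hac, max_eq_right (le_min h hcb),
        max_eq_right (hac.trans (le_min h hcb))]
      abel
  unfold Elementary.integral
  rw [← Finset.sum_add_distrib]
  refine Finset.sum_congr rfl fun l _ => ?_
  rw [key, key, ← map_add]
  congr 1
  abel

omit [IsProbabilityMeasure P] in
-- One sequence serves all three intervals because energy is monotone in the interval. This is why
-- the definition quantifies over every approximating sequence.
lemma IsNoise.isStochasticIntegral_add (hw : IsNoise P ℱ V w₀ w₁) {a b c : T} (hac : a ≤ c)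
    (hcb : c ≤ b) {S : T → Ω → Lr r n h} {Yab Yac Ycb : Ω → Fin h → CDC r}
    (hab : IsStochasticIntegral P ℱ V (combine w₀ w₁) S a b Yab)
    (hYac : IsStochasticIntegral P ℱ V (combine w₀ w₁) S a c Yac)
    (hYcb : IsStochasticIntegral P ℱ V (combine w₀ w₁) S c b Ycb) :
    ∀ᵐ ω ∂P, Yab ω = Yac ω + Ycb ω := by
  obtain ⟨E, hE⟩ := hab.exists_approx
  have h1 := tendsto_lintegral_normSq_iff.1 (hab.tendsto E hE)
  have h2 := tendsto_lintegral_normSq_iff.1 (hYac.tendsto E (hE.mono le_rfl hcb))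
  have h3 := tendsto_lintegral_normSq_iff.1 (hYcb.tendsto E (hE.mono hac le_rfl))
  have hmI := fun κ (β γ : T) => hw.measurable_integral (E κ) β γ
  refine ae_eq_of_meanNorm_eq_zero hab.measurable (hYac.measurable.add hYcb.measurable) ?_
  have hsum := h1.add (h2.add h3)
  simp only [add_zero] at hsum
  refine le_antisymm (ge_of_tendsto' hsum fun κ => ?_) bot_le
  refine (meanNorm_sub_le (P := P) hab.measurable (hmI κ a b)
    (hYac.measurable.add hYcb.measurable)).trans ?_
  rw [meanNorm_sub_comm Yab]
  refine add_le_add_right (le_of_eq_of_le (congrArg (meanNorm P) (funext fun ω => ?_))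
    (meanNorm_add_le ((hmI κ a c).sub hYac.measurable) ((hmI κ c b).sub hYcb.measurable))) _
  rw [(E κ).integral_add_integral _ hac hcb]
  exact add_sub_add_comm _ _ _ _

end Existence

end CayleyDickson

end

theorem proposition2p20 {Ω : Type*} [mΩ : MeasurableSpace Ω] (P : Measure Ω)
    [IsProbabilityMeasure P] (r n h : ℕ) (hr : 2 ≤ r) (T : Set ℝ) (hT : CayleyDickson.IsTimeSet T)
    (ℱ : Filtration T mΩ) (hℱ : CayleyDickson.IsNormal P ℱ)
    (U V : Fin 2 → CayleyDickson.Lr r n n)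
    (hU : ∀ k, CayleyDickson.IsLri (U k)) (hV : ∀ k, CayleyDickson.IsLri (V k))
    (hUV : ∀ k, CayleyDickson.IsSqrtOf (V k) (U k))
    (w₀ w₁ : T → Ω → Fin n → CayleyDickson.CD r) (hw : CayleyDickson.IsNoise P ℱ V w₀ w₁)
    (a b : T) (hab : a < b) (S : T → Ω → CayleyDickson.Lr r n h)
    (hS : S ∈ CayleyDickson.V21 P ℱ V a b h) :
    (∀ β γ : T, a ≤ β → β ≤ γ → γ ≤ b →
      ∃ Y : Ω → Fin h → CayleyDickson.CDC r,
        CayleyDickson.IsStochasticIntegral P ℱ V (CayleyDickson.combine w₀ w₁) S β γ Y ∧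
        ∀ Y' : Ω → Fin h → CayleyDickson.CDC r,
          CayleyDickson.IsStochasticIntegral P ℱ V (CayleyDickson.combine w₀ w₁) S β γ Y' →
          Y' =ᵐ[P] Y) ∧
    (∀ c : T, a < c → c < b → ∀ Yab Yac Ycb : Ω → Fin h → CayleyDickson.CDC r,
      CayleyDickson.IsStochasticIntegral P ℱ V (CayleyDickson.combine w₀ w₁) S a b Yab →
      CayleyDickson.IsStochasticIntegral P ℱ V (CayleyDickson.combine w₀ w₁) S a c Yac →
      CayleyDickson.IsStochasticIntegral P ℱ V (CayleyDickson.combine w₀ w₁) S c b Ycb →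
      ∀ᵐ ω ∂P, Yab ω = Yac ω + Ycb ω) := by
  refine ⟨fun β γ ha hβγ hb => ?_, fun c hac hcb Yab Yac Ycb h1 h2 h3 =>
    hw.isStochasticIntegral_add hac.le hcb.le h1 h2 h3⟩
  obtain ⟨Y, hY⟩ := hw.exists_isStochasticIntegral hT hab ha hβγ hb hS
  exact ⟨Y, hY, fun Y' hY' => hw.isStochasticIntegral_unique hY hY'⟩
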